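/- Let $H<\mathrm{GL}(d,\mathbb{R})$ be a closed subgroup with left Haar measure $dh$, and let $G=\mathbb{R}^d\rtimes H$ with product $(x,h)(y,g)=(x+hy,hg)$ and left Haar measure $d(x,h)=|\det h|^{-1}\,dx\,dh$. Let $\pi$ be the quasi-regular representation of $G$ on $L^2(\mathbb{R}^d)$, $[\pi(x,h)f](y)=|\det h|^{-1/2}f(h^{-1}(y-x))$, and write $\mathcal{W}_\psi f(x,h)=\langle f,\pi(x,h)\psi\rangle$ for $f,\psi\in L^2(\mathbb{R}^d)$. A weight on a topological group is a continuous, strictly positive function $u$ with $u(g_1g_2)\le u(g_1)u(g_2)$ for all $g_1,g_2$. For a weight $v$ on $G$ let $L^1_v(G)$ be the space of measurable $F:G\to\mathbb{C}$ with $\int_H\int_{\mathbb{R}^d}|F(x,h)|\,v(x,h)\,dx\,\frac{dh}{|\det h|}<\infty$. Assume that $\pi$ is irreducible (there are no closed $\pi$-invariant subspaces other than $\{0\}$ and $L^2(\mathbb{R}^d)$) and square-integrable (there is a nonzero $\psi\in L^2(\mathbb{R}^d)$ with $\mathcal{W}_\psi\psi\in L^2(G)$). Let $v$ be a weight on $G$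 for which there are $s\in\mathbb{R}$ and a weight $w$ on $H$ with $v(x,h)\le(1+|x|)^s\,w(h)$ for all $(x,h)\in G$. Then the dual action $(\xi,h)\mapsto h^T\xi$ of $H$ on $\mathbb{R}^d$ has exactly one open orbit $\mathcal{O}=\{h^T\xi_0:h\in H\}$, and $\pi$ is $v$-integrable, i.e. there is a nonzero $\psi\in L^2(\mathbb{R}^d)$ with $\mathcal{W}_\psi\psi\in L^1_v(G)$. In fact, every $\psi\in L^2(\mathbb{R}^d)$ whose Fourier transform $\widehat\psi$ is a smooth function with compact support contained in $\mathcal{O}$ satisfies $\mathcal{W}_\psi\psi\in L^1_v(G)$. -/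

import Mathlib

open MeasureTheory
open scoped ENNReal ContDiff FourierTransform

/-- `ℝ^d` with the euclidean scalar product and norm. -/
abbrev Euc (d : ℕ) : Type := EuclideanSpace ℝ (Fin d)

/-- The Hilbert space `L²(ℝ^d)` of complex-valued functions. -/
abbrev L2 (d : ℕ) : Type := Lp (α := Euc d) ℂ 2 volume

/-- The linear map `x ↦ A x` of `ℝ^d` given by a `d × d` matrix `A`. -/
noncomputable def matAct {d : ℕ} (A : Matrix (Fin d) (Fin d) ℝ) : Euc d →L[ℝ] Euc d :=
  Matrix.toEuclideanCLM (𝕜 := ℝ) A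

theorem matAct_one {d : ℕ} (x : Euc d) : matAct (1 : Matrix (Fin d) (Fin d) ℝ) x = x := by
  simp [matAct]

theorem matAct_mul {d : ℕ} (A B : Matrix (Fin d) (Fin d) ℝ) (x : Euc d) :
    matAct (A * B) x = matAct A (matAct B x) := by
  simp [matAct]

theorem det_matAct {d : ℕ} (A : Matrix (Fin d) (Fin d) ℝ) :
    LinearMap.det (matAct A : Euc d →ₗ[ℝ] Euc d) = A.det := by
  have : (matAct A : Euc d →ₗ[ℝ] Euc d) = Matrix.toLpLin 2 2 A := rfl
  rw [this, Matrix.toLpLin_eq_toLin, LinearMap.det_toLin]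

/-- The real `d × d` matrix underlying an element of a matrix group `H < GL(d, ℝ)`. -/
def mat {d : ℕ} {H : Subgroup (GL (Fin d) ℝ)} (h : H) : Matrix (Fin d) (Fin d) ℝ :=
  ((h : GL (Fin d) ℝ) : Matrix (Fin d) (Fin d) ℝ)

theorem mat_one {d : ℕ} {H : Subgroup (GL (Fin d) ℝ)} : mat (1 : H) = 1 := rfl

theorem mat_mul {d : ℕ} {H : Subgroup (GL (Fin d) ℝ)} (h g : H) :
    mat (h * g) = mat h * mat g := rfl

theorem mat_inv_mul {d : ℕ} {H : Subgroup (GL (Fin d) ℝ)} (h : H) :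
    mat h⁻¹ * mat h = 1 := by
  rw [← mat_mul, inv_mul_cancel, mat_one]

theorem mat_det_ne_zero {d : ℕ} {H : Subgroup (GL (Fin d) ℝ)} (h : H) : (mat h).det ≠ 0 := by
  intro h0
  have h1 := congrArg Matrix.det (mat_inv_mul h)
  rw [Matrix.det_mul, h0, mul_zero, Matrix.det_one] at h1
  exact zero_ne_one h1

/-- A matrix group carries its Borel σ-algebra. -/
instance matrixGroupMeasurableSpace {d : ℕ} (H : Subgroup (GL (Fin d) ℝ)) :
    MeasurableSpace H := borel H

instance matrixGroupBorelSpace {d : ℕ} (H : Subgroup (GL (Fin d) ℝ)) : BorelSpace H := ⟨rfl⟩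

/-- The semidirect product `G = ℝ^d ⋊ H`: pairs `(x, h)`, with the product topology and the
product σ-algebra. -/
def AffGroup {d : ℕ} (H : Subgroup (GL (Fin d) ℝ)) : Type := Euc d × H

namespace AffGroup

instance {d : ℕ} (H : Subgroup (GL (Fin d) ℝ)) : TopologicalSpace (AffGroup H) :=
  inferInstanceAs (TopologicalSpace (Euc d × H))

instance {d : ℕ} (H : Subgroup (GL (Fin d) ℝ)) : MeasurableSpace (AffGroup H) :=
  inferInstanceAs (MeasurableSpace (Euc d × H))

/-- The element `(x, h)` of `ℝ^d ⋊ H`. -/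
def mk {d : ℕ} {H : Subgroup (GL (Fin d) ℝ)} (x : Euc d) (h : H) : AffGroup H := (x, h)

/-- The translation part `x` of `(x, h)`. -/
def trans {d : ℕ} {H : Subgroup (GL (Fin d) ℝ)} (g : AffGroup H) : Euc d := Prod.fst g

/-- The dilation part `h` of `(x, h)`. -/
def dil {d : ℕ} {H : Subgroup (GL (Fin d) ℝ)} (g : AffGroup H) : H := Prod.snd g

/-- The group law `(x, h) (y, g) = (x + h y, h g)`. -/
noncomputable instance {d : ℕ} (H : Subgroup (GL (Fin d) ℝ)) : Group (AffGroup H) where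
  mul a b := mk (a.trans + matAct (mat a.dil) b.trans) (a.dil * b.dil)
  one := mk 0 1
  inv a := mk (-matAct (mat a.dil⁻¹) a.trans) a.dil⁻¹
  mul_assoc a b c := by
    refine Prod.ext ?_ (mul_assoc a.dil b.dil c.dil)
    change (a.trans + matAct (mat a.dil) b.trans) + matAct (mat (a.dil * b.dil)) c.trans
      = a.trans + matAct (mat a.dil) (b.trans + matAct (mat b.dil) c.trans)
    rw [mat_mul, matAct_mul, map_add, add_assoc]
  one_mul a := by
    refine Prod.ext ?_ (one_mul a.dil)
    change 0 + matAct (mat (1 : H)) a.trans = a.trans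
    rw [mat_one, matAct_one, zero_add]
  mul_one a := by
    refine Prod.ext ?_ (mul_one a.dil)
    change a.trans + matAct (mat a.dil) 0 = a.trans
    rw [map_zero, add_zero]
  inv_mul_cancel a := by
    refine Prod.ext ?_ (inv_mul_cancel a.dil)
    change -matAct (mat a.dil⁻¹) a.trans + matAct (mat a.dil⁻¹) a.trans = 0
    exact neg_add_cancel _

end AffGroup

/-- The left Haar measure `d(x, h) = |det h|⁻¹ dx dh` of `ℝ^d ⋊ H`, where `dh = μH` is a left
Haar measure of `H`. -/
noncomputable def affHaar {d : ℕ} {H : Subgroup (GL (Fin d) ℝ)} (μH : Measure H) :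
    Measure (AffGroup H) :=
  ((volume : Measure (Euc d)).prod μH).withDensity
    (fun p => ENNReal.ofReal (|(mat p.2).det|⁻¹))

/-- The pointwise formula `y ↦ |det h|^{-1/2} f (h⁻¹ (y - x))`. -/
noncomputable def quasiRegFun {d : ℕ} {H : Subgroup (GL (Fin d) ℝ)} (g : AffGroup H)
    (f : Euc d → ℂ) : Euc d → ℂ :=
  fun y => ((|(mat g.dil).det| ^ (-(1 / 2) : ℝ) : ℝ) : ℂ) *
    f (matAct (mat g.dil⁻¹) (y - g.trans))

theorem quasiRegFun_memLp {d : ℕ} {H : Subgroup (GL (Fin d) ℝ)} (g : AffGroup H)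
    {f : Euc d → ℂ} (hf : MemLp f 2 volume) : MemLp (quasiRegFun g f) 2 volume := by
  have hdet : LinearMap.det (matAct (mat g.dil⁻¹) : Euc d →ₗ[ℝ] Euc d) ≠ 0 := by
    rw [det_matAct]
    exact mat_det_ne_zero _
  have hmap := Measure.map_linearMap_addHaar_eq_smul_addHaar (volume : Measure (Euc d)) hdet
  have h1 : MemLp (f ∘ matAct (mat g.dil⁻¹)) 2 volume := by
    refine MemLp.comp_of_map ?_ (matAct (mat g.dil⁻¹)).continuous.measurable.aemeasurable
    have h2 : Measure.map (matAct (mat g.dil⁻¹)) (volume : Measure (Euc d)) = _ := hmap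
    rw [h2]
    exact hf.smul_measure ENNReal.ofReal_ne_top
  exact (h1.comp_measurePreserving (measurePreserving_sub_right volume g.trans)).const_mul _

/-- The quasi-regular representation of `ℝ^d ⋊ H` on `L²(ℝ^d)`:
`[π(x, h) f](y) = |det h|^{-1/2} f (h⁻¹ (y - x))`. -/
noncomputable def quasiReg {d : ℕ} {H : Subgroup (GL (Fin d) ℝ)} (g : AffGroup H)
    (f : L2 d) : L2 d :=
  (quasiRegFun_memLp g (Lp.memLp f)).toLp (quasiRegFun g f)

/-- The wavelet transform `W_ψ f (x, h) = ⟨f, π(x, h) ψ⟩`, with the scalar product of `L²` linear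
in the left argument (Mathlib's `inner` is linear in the right one). -/
noncomputable def wavelet {d : ℕ} {H : Subgroup (GL (Fin d) ℝ)} (ψ f : L2 d)
    (g : AffGroup H) : ℂ :=
  inner ℂ (quasiReg g ψ) f

/-- The quasi-regular representation is irreducible: there is no closed invariant subspace of
`L²(ℝ^d)` other than `0` and the whole space. -/
def QuasiRegIrreducible {d : ℕ} (H : Subgroup (GL (Fin d) ℝ)) : Prop :=
  ∀ K : Submodule ℂ (L2 d), IsClosed (K : Set (L2 d)) →
    (∀ g : AffGroup H, ∀ f ∈ K, quasiReg g f ∈ K) → K = ⊥ ∨ K = ⊤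

/-- The quasi-regular representation is square-integrable: for some nonzero `ψ ∈ L²(ℝ^d)` the
matrix coefficient `W_ψ ψ` is in `L²(G)`. -/
def QuasiRegSquareIntegrable {d : ℕ} (H : Subgroup (GL (Fin d) ℝ)) (μH : Measure H) : Prop :=
  ∃ ψ : L2 d, ψ ≠ 0 ∧ MemLp (fun g : AffGroup H => wavelet ψ ψ g) 2 (affHaar μH)

/-- A weight on a topological group: a continuous positive submultiplicative function. -/
structure IsWeight {G : Type*} [Group G] [TopologicalSpace G] (v : G → ℝ) : Prop where
  continuous : Continuous v
  pos : ∀ g, 0 < v g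
  submul : ∀ g₁ g₂, v (g₁ * g₂) ≤ v g₁ * v g₂

/-- Membership in the weighted space `L¹_v(G)`: `F` is measurable and
`∫_H ∫_{ℝ^d} |F(x, h)| v(x, h) dx |det h|⁻¹ dh` is finite. -/
def MemL1v {d : ℕ} {H : Subgroup (GL (Fin d) ℝ)} (μH : Measure H) (v : AffGroup H → ℝ)
    (F : AffGroup H → ℂ) : Prop :=
  AEStronglyMeasurable F (affHaar μH) ∧ Integrable (fun g => ‖F g‖ * v g) (affHaar μH)

/-- The quasi-regular representation is `v`-integrable: there is a nonzero `v`-integrable vector,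
that is, a nonzero `ψ ∈ L²(ℝ^d)` with `W_ψ ψ ∈ L¹_v(G)`. -/
def QuasiRegIntegrable {d : ℕ} (H : Subgroup (GL (Fin d) ℝ)) (μH : Measure H)
    (v : AffGroup H → ℝ) : Prop :=
  ∃ ψ : L2 d, ψ ≠ 0 ∧ MemL1v μH v (wavelet ψ ψ)

/-- The orbit `{hᵀ ξ₀ : h ∈ H}` of the dual action. -/
def dualOrbit {d : ℕ} (H : Subgroup (GL (Fin d) ℝ)) (ξ₀ : Euc d) : Set (Euc d) :=
  Set.range fun h : H => matAct (mat h).transpose ξ₀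

/-- `O` is an open orbit of the dual action. -/
def IsOpenDualOrbit {d : ℕ} (H : Subgroup (GL (Fin d) ℝ)) (O : Set (Euc d)) : Prop :=
  IsOpen O ∧ ∃ ξ₀ : Euc d, O = dualOrbit H ξ₀

/-- `ψ ∈ 𝓕⁻¹ C_c^∞(O)`: the (Plancherel) Fourier transform of `ψ` is, almost everywhere, a smooth
function whose closed support is compact and contained in `O`. -/
def FourierInCcInfty {d : ℕ} (O : Set (Euc d)) (ψ : L2 d) : Prop :=
  ∃ f : Euc d → ℂ, ContDiff ℝ ∞ f ∧ HasCompactSupport f ∧ tsupport f ⊆ O ∧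
    (𝓕 ψ : L2 d) =ᵐ[volume] f

/-! On the Fourier side `π(x, h)` acts by `F ↦ |det h|^{1/2} e^{-2πi⟨x, ξ⟩} F(hᵀ ξ)`, so for fixed
`h` the function `W_ψ f(·, h)` is `|det h|^{1/2}` times the inverse Fourier transform of `f̂ · conj
(ψ̂ ∘ hᵀ)`. Everything is then read off from the dual action.

A conull orbit. An invariant Borel set `B` yields the closed invariant subspace of those `f` with
`f̂ = 0` off `B`, so irreducibility makes the dual action ergodic and all orbit integrals `∫_H b(hᵀ
ξ) dh` are a.e. constant in `ξ`. By Plancherel, square-integrability says `∫ |ψ̂(ξ)|² ∫_H |ψ̂(hᵀ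
ξ)|² dh dξ < ∞`, so a nonnull level set `E` of `|ψ̂|²` has finite orbit integrals. The images of
Haar measure under `h ↦ hᵀ ξ`, restricted to `E`, are then a.e. finite, nonzero and, tested on a
countable π-system, all equal. Being carried by orbits, they force almost every `ξ` into one orbit
(`exists_conull_dualOrbit`).

Openness. If the Lie algebra of the dual group does not move `ξ` in all directions, the orbit is a
countable union of linear images of a set of critical values, hence null
(`IsClosedUnitGroup.isOpen_orbit_of_measure_ne_zero`). So the conull orbit is open, and any other
open orbit would meet it.

Integrability. The finite positive measure of `{h | hᵀ ξ₀ ∈ E}` forces the stabilizer of `ξ₀` to be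
relatively compact. With the openness of the orbit map this makes the action proper on `O`
(`exists_isCompact_return`). Hence for `ψ̂ ∈ C_c^∞(O)` the function `W_ψ ψ` vanishes for `h` outside
a compact set and decays rapidly in `x`, uniformly on that set. This beats the polynomial growth of
`v`. -/

/-! ### Closed linear groups: Lie algebra, and nonnull orbits are open -/

section MatrixLieGroups

open Filter Topology NormedSpace

variable {A : Type*} [NormedRing A] [NormedAlgebra ℝ A] [CompleteSpace A]

theorem exp_add_smul_real (s t : ℝ) (X : A) :
    exp ((s + t) • X) = exp (s • X) * exp (t • X) := by
  let := NormedAlgebra.restrictScalars ℚ ℝ A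
  rw [add_smul, exp_add_of_commute]
  exact ((Commute.refl X).smul_left s).smul_right t

theorem exp_nsmul_real (n : ℕ) (X : A) : exp ((n : ℝ) • X) = exp X ^ n := by
  let := NormedAlgebra.restrictScalars ℚ ℝ A
  rw [← exp_nsmul]
  congr 1
  exact Nat.cast_smul_eq_nsmul ℝ n X

theorem exp_mul_exp_neg_real (X : A) : exp X * exp (-X) = 1 := by
  have := exp_add_smul_real 1 (-1) X
  simpa using this.symm

theorem exp_neg_mul_exp_real (X : A) : exp (-X) * exp X = 1 := by
  simpa using exp_mul_exp_neg_real (-X)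

theorem continuous_exp_real : Continuous (exp : A → A) :=
  continuous_iff_continuousAt.2 fun X => (exp_analytic (𝕂 := ℝ) X).continuousAt

/-- If `h i → 1` at speed `1 / t i` in the direction `X`, then suitable powers of `h i` tend to
`exp (r • X)`. -/
theorem tendsto_pow_exp {ι : Type*} {l : Filter ι} {t : ι → ℝ} {h : ι → A} {X : A}
    (ht : Tendsto t l atTop) (hX : Tendsto (fun i => t i • (h i - 1)) l (𝓝 X))
    {r : ℝ} (hr : 0 ≤ r) :
    Tendsto (fun i => h i ^ ⌊r * t i⌋₊) l (𝓝 (exp (r • X))) := by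
  have hexp : HasStrictFDerivAt (exp : A → A)
      ((ContinuousLinearEquiv.refl ℝ A : A ≃L[ℝ] A) : A →L[ℝ] A) 0 :=
    hasStrictFDerivAt_exp_zero (𝕂 := ℝ)
  set log := hexp.localInverse exp _ 0
  have hlog : HasStrictFDerivAt log (((ContinuousLinearEquiv.refl ℝ A).symm : A ≃L[ℝ] A) : A →L[ℝ] A)
      (exp 0) := hexp.to_localInverse
  have hlog1 : log (exp 0) = 0 := hexp.localInverse_apply_image
  rw [exp_zero] at hlog hlog1
  have h2 : Tendsto h l (𝓝 1) := by
    have : Tendsto (fun i => 1 + (t i)⁻¹ • (t i • (h i - 1))) l (𝓝 (1 + (0 : ℝ) • X)) :=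
      tendsto_const_nhds.add ((tendsto_inv_atTop_zero.comp ht).smul hX)
    rw [zero_smul, add_zero] at this
    refine this.congr' ?_
    filter_upwards [ht.eventually_gt_atTop 0] with i hi
    rw [smul_smul, inv_mul_cancel₀ hi.ne', one_smul, add_sub_cancel]
  -- The local logarithm has derivative the identity at `1`, so `log (h i)` and `h i - 1` agree to
  -- first order.
  have h1 : Tendsto (fun i => t i • log (h i)) l (𝓝 X) := by
    have := hlog.hasFDerivAt.hasFDerivWithinAt (s := Set.univ) |>.lim (l := l) (c := t)
      (d := fun i => h i - 1) (v := X) (by simpa using h2.sub_const 1)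
      (Eventually.of_forall fun _ => trivial) hX
    simpa [hlog1] using this
  have h3 : ∀ᶠ i in l, exp (log (h i)) = h i := by
    have := hexp.eventually_right_inverse
    rw [exp_zero] at this
    exact h2.eventually this
  have h4 : Tendsto (fun i => (⌊r * t i⌋₊ : ℝ) / t i) l (𝓝 r) :=
    (tendsto_nat_floor_mul_div_atTop hr).comp ht
  have h5 : Tendsto (fun i => exp (((⌊r * t i⌋₊ : ℝ) / t i) • (t i • log (h i)))) l
      (𝓝 (exp (r • X))) := (continuous_exp_real.tendsto _).comp (h4.smul h1)
  refine h5.congr' ?_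
  filter_upwards [h3, ht.eventually_gt_atTop 0] with i hi hi0
  rw [smul_smul, div_mul_cancel₀ _ hi0.ne', exp_nsmul_real, hi]

/-- A submonoid of a Banach algebra that is a group and is closed in the group of units. -/
structure IsClosedUnitGroup (Γ : Submonoid A) : Prop where
  inv : ∀ a ∈ Γ, ∃ b ∈ Γ, a * b = 1 ∧ b * a = 1
  closed : ∀ a ∈ closure (Γ : Set A), IsUnit a → a ∈ Γ

theorem isUnit_exp_real (X : A) : IsUnit (exp X) :=
  ⟨⟨exp X, exp (-X), exp_mul_exp_neg_real X, exp_neg_mul_exp_real X⟩, rfl⟩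

/-- For `r ≥ 0` the point is a limit of powers of elements of `Γ` and is a unit; negative `r`
follows by inversion. This is the tool for producing elements of the Lie algebra. -/
theorem IsClosedUnitGroup.exp_smul_mem {Γ : Submonoid A} (hΓ : IsClosedUnitGroup Γ)
    {ι : Type*} {l : Filter ι} [l.NeBot] {t : ι → ℝ} {h : ι → A} {X : A}
    (hh : ∀ᶠ i in l, h i ∈ Γ)
    (ht : Tendsto t l atTop) (hX : Tendsto (fun i => t i • (h i - 1)) l (𝓝 X)) (r : ℝ) :
    exp (r • X) ∈ Γ := by
  have key : ∀ r : ℝ, 0 ≤ r → exp (r • X) ∈ Γ := fun r hr =>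
    hΓ.closed _ (mem_closure_of_tendsto (tendsto_pow_exp ht hX hr)
      (hh.mono fun i hi => Γ.pow_mem hi _)) (isUnit_exp_real _)
  rcases le_total 0 r with hr | hr
  · exact key r hr
  · obtain ⟨b, hb, hab, hba⟩ := hΓ.inv _ (key (-r) (by linarith))
    have h1 : exp (r • X) * exp ((-r) • X) = 1 := by
      have := exp_mul_exp_neg_real (r • X)
      rwa [← neg_smul] at this
    have : exp (r • X) = b := by
      calc exp (r • X) = exp (r • X) * (exp ((-r) • X) * b) := by rw [hab, mul_one]
        _ = b := by rw [← mul_assoc, h1, one_mul]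
    rwa [this]

/-- The Lie algebra `{X | exp (t X) ∈ Γ for all t}` of a closed group of units. -/
def IsClosedUnitGroup.lie {Γ : Submonoid A} (hΓ : IsClosedUnitGroup Γ) : Submodule ℝ A where
  carrier := {X | ∀ t : ℝ, exp (t • X) ∈ Γ}
  zero_mem' t := by simp
  smul_mem' c X hX t := by
    rw [smul_smul]; exact hX _
  add_mem' {X Y} hX hY := by
    -- The curve `s ↦ exp (s X) exp (s Y)` lies in `Γ` and has velocity `X + Y` at `0`; it is
    -- sampled at `s = 1 / n`.
    refine hΓ.exp_smul_mem (l := atTop) (t := fun n : ℕ => (n : ℝ))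
      (h := fun n => exp ((n : ℝ)⁻¹ • X) * exp ((n : ℝ)⁻¹ • Y))
      (Eventually.of_forall fun n => Γ.mul_mem (hX _) (hY _)) tendsto_natCast_atTop_atTop ?_
    have h0 : HasFDerivAt (exp : A → A) (1 : A →L[ℝ] A) ((0 : ℝ) • X) := by
      rw [zero_smul]; exact (hasStrictFDerivAt_exp_zero (𝕂 := ℝ)).hasFDerivAt
    have h0' : HasFDerivAt (exp : A → A) (1 : A →L[ℝ] A) ((0 : ℝ) • Y) := by
      rw [zero_smul]; exact (hasStrictFDerivAt_exp_zero (𝕂 := ℝ)).hasFDerivAt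
    have h1 : HasDerivAt (fun s : ℝ => exp (s • X)) X 0 := by
      simpa [Function.comp_def] using h0.comp_hasDerivAt (0 : ℝ) ((hasDerivAt_id (0 : ℝ)).smul_const X)
    have h2 : HasDerivAt (fun s : ℝ => exp (s • Y)) Y 0 := by
      simpa [Function.comp_def] using h0'.comp_hasDerivAt (0 : ℝ) ((hasDerivAt_id (0 : ℝ)).smul_const Y)
    have h3 := h1.mul h2
    have h4 := h3.tendsto_slope_zero_right
    have h5 : Tendsto (fun n : ℕ => (n : ℝ)⁻¹) atTop (𝓝[>] 0) :=
      tendsto_inv_atTop_nhdsGT_zero.comp tendsto_natCast_atTop_atTop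
    have h6 := h4.comp h5
    simpa [Function.comp_def] using h6

variable {E : Type*} [NormedAddCommGroup E] [NormedSpace ℝ E]

/-- Homogeneity: each element of `Γ` is a homeomorphism preserving the orbit, so one interior point
suffices. -/
theorem isOpen_orbit_of_mem_nhds {Γ : Submonoid (E →L[ℝ] E)} (hΓ : IsClosedUnitGroup Γ) {ξ : E}
    (h : (fun a : E →L[ℝ] E => a ξ) '' Γ ∈ 𝓝 ξ) :
    IsOpen ((fun a : E →L[ℝ] E => a ξ) '' (Γ : Set (E →L[ℝ] E))) := by
  rw [isOpen_iff_mem_nhds]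
  rintro _ ⟨a, ha, rfl⟩
  obtain ⟨b, hb, hab, hba⟩ := hΓ.inv a ha
  have hb' : Tendsto b (𝓝 (a ξ)) (𝓝 ξ) := by
    have := b.continuous.tendsto (a ξ)
    rwa [← mul_apply_eq_comp, hba] at this
  filter_upwards [hb' h]
  rintro η ⟨c, hc, hcη⟩
  refine ⟨a * c, Γ.mul_mem ha hc, ?_⟩
  change a (c ξ) = η
  rw [show c ξ = b η from hcη, ← mul_apply_eq_comp, hab]
  rfl

theorem hasStrictFDerivAt_exp_comp_zero {F : Type*} [NormedAddCommGroup F] [NormedSpace ℝ F]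
    (L : F →L[ℝ] A) : HasStrictFDerivAt (fun Z => exp (L Z)) L (0 : F) := by
  have h0 : HasStrictFDerivAt (exp : A → A) (1 : A →L[ℝ] A) (L 0) := by
    rw [map_zero]; exact hasStrictFDerivAt_exp_zero (𝕂 := ℝ)
  exact h0.comp (0 : F) L.hasStrictFDerivAt

variable [FiniteDimensional ℝ E]

/-- If the Lie algebra acts transitively at `ξ`, the orbit of `ξ` is open. -/
theorem IsClosedUnitGroup.isOpen_orbit {Γ : Submonoid (E →L[ℝ] E)} (hΓ : IsClosedUnitGroup Γ)
    {ξ : E} (hs : ∀ y : E, ∃ X ∈ hΓ.lie, X ξ = y) :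
    IsOpen ((fun a : E →L[ℝ] E => a ξ) '' (Γ : Set (E →L[ℝ] E))) := by
  refine isOpen_orbit_of_mem_nhds hΓ ?_
  have h1 := hasStrictFDerivAt_exp_comp_zero hΓ.lie.subtypeL
  have h2 : HasStrictFDerivAt (fun Z : hΓ.lie => (exp (hΓ.lie.subtypeL Z)) ξ)
      ((ContinuousLinearMap.apply ℝ E ξ).comp hΓ.lie.subtypeL) 0 :=
    (ContinuousLinearMap.apply ℝ E ξ).hasStrictFDerivAt.comp (0 : hΓ.lie) h1
  -- The derivative at `0` of `Z ↦ exp(Z) ξ` is `Z ↦ Z ξ`, onto by assumption, so the map is open at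
  -- `0`.
  have h3 := h2.map_nhds_eq_of_surj (by
    rw [LinearMap.range_eq_top]
    intro y
    obtain ⟨X, hX, hXy⟩ := hs y
    exact ⟨⟨X, hX⟩, hXy⟩)
  have h4 : Set.range (fun Z : hΓ.lie => (exp (hΓ.lie.subtypeL Z)) ξ) ∈
      map (fun Z : hΓ.lie => (exp (hΓ.lie.subtypeL Z)) ξ) (𝓝 0) := range_mem_map
  rw [h3] at h4
  simp only [map_zero, exp_zero, one_apply_eq_self] at h4
  refine mem_of_superset h4 ?_
  rintro _ ⟨Z, rfl⟩
  refine ⟨exp (Z : E →L[ℝ] E), ?_, rfl⟩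
  simpa using Z.2 1

/-- Near `1`, a closed group of units is contained in the set of products
`exp (M Z) * exp (S Z)`, where `M + S` is a projection onto the Lie algebra. -/
theorem IsClosedUnitGroup.eventually_mem_exp_mul_exp [FiniteDimensional ℝ A] {Γ : Submonoid A}
    (hΓ : IsClosedUnitGroup Γ) (M S : A →L[ℝ] A) (hM : ∀ Z, M Z ∈ hΓ.lie)
    (hS : ∀ Z, S Z ∈ hΓ.lie) (hMS : ∀ Z ∈ hΓ.lie, M Z + S Z = Z) :
    ∀ᶠ a in 𝓝 (1 : A), a ∈ Γ → ∃ Z, a = exp (M Z) * exp (S Z) := by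
  -- `N` is the projection onto a complement of the Lie algebra. `Ψ` has derivative `M + S + N = id`
  -- at `0`, so it is a local chart at `1`; the claim is that `N Z = 0` whenever `Ψ Z ∈ Γ` with `Z`
  -- near `0`.
  set N : A →L[ℝ] A := ContinuousLinearMap.id ℝ A - M - S
  have hNapp : ∀ Z, N Z = Z - M Z - S Z := fun Z => rfl
  have hN0 : ∀ Z ∈ hΓ.lie, N Z = 0 := fun Z hZ => by
    rw [hNapp, sub_sub, hMS Z hZ, sub_self]
  have hNN : ∀ Z, N (N Z) = N Z := fun Z => by
    conv_lhs => rw [hNapp Z]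
    rw [map_sub, map_sub, hN0 _ (hM Z), hN0 _ (hS Z), sub_zero, sub_zero]
  set Ψ : A → A := fun Z => exp (M Z) * exp (S Z) * exp (N Z) with hΨ
  have hder : HasStrictFDerivAt Ψ ((ContinuousLinearEquiv.refl ℝ A : A ≃L[ℝ] A) : A →L[ℝ] A) 0 := by
    have := ((hasStrictFDerivAt_exp_comp_zero M).mul' (hasStrictFDerivAt_exp_comp_zero S)).mul'
      (hasStrictFDerivAt_exp_comp_zero N)
    refine this.congr_fderiv ?_
    ext Z
    simp [hNapp]
    abel
  have hmap := hder.map_nhds_eq_of_equiv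
  have hΨ0 : Ψ 0 = 1 := by simp [hΨ]
  rw [hΨ0] at hmap
  have key : ∀ᶠ Z in 𝓝 (0 : A), Ψ Z ∈ Γ → N Z = 0 := by
    by_contra hcon
    rw [not_eventually] at hcon
    simp only [Classical.not_imp] at hcon
    obtain ⟨Z, hZ, hZ'⟩ := exists_seq_forall_of_frequently hcon
    have hNΓ : ∀ n, exp (N (Z n)) ∈ Γ := by
      intro n
      have h1 : exp (-S (Z n)) ∈ Γ := by simpa using hS (Z n) (-1)
      have h2 : exp (-M (Z n)) ∈ Γ := by simpa using hM (Z n) (-1)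
      have h3 := Γ.mul_mem (Γ.mul_mem h1 h2) (hZ' n).1
      convert h3 using 1
      simp only [hΨ]
      calc exp (N (Z n)) = (exp (-S (Z n)) * exp (S (Z n))) * exp (N (Z n)) := by
            rw [exp_neg_mul_exp_real, one_mul]
        _ = exp (-S (Z n)) * (exp (-M (Z n)) * exp (M (Z n))) * exp (S (Z n)) * exp (N (Z n)) := by
            rw [exp_neg_mul_exp_real (M (Z n)), mul_one]
        _ = _ := by simp only [mul_assoc]
    -- A limit direction `X` of `N (Z n)` lies in the Lie algebra, so `N X = 0`, but also in the
    -- range of `N`, so `N X = X`. This contradicts `‖X‖ = 1`.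
    set u : ℕ → A := fun n => ‖N (Z n)‖⁻¹ • N (Z n)
    have hu : ∀ n, u n ∈ Metric.sphere (0 : A) 1 := by
      intro n
      have : ‖N (Z n)‖ ≠ 0 := norm_ne_zero_iff.2 (hZ' n).2
      simp [u, norm_smul, this]
    have : ProperSpace A := FiniteDimensional.proper_real A
    obtain ⟨X, hX, φ, hφ, hlim⟩ := (isCompact_sphere (0 : A) 1).tendsto_subseq hu
    have hNZ : Tendsto (fun n => N (Z (φ n))) atTop (𝓝 0) := by
      have := (N.continuous.tendsto 0).comp (hZ.comp hφ.tendsto_atTop)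
      rwa [map_zero] at this
    have hXlie : X ∈ hΓ.lie := by
      refine hΓ.exp_smul_mem (l := atTop) (t := fun n => ‖N (Z (φ n))‖⁻¹)
        (h := fun n => exp (N (Z (φ n)))) (Eventually.of_forall fun n => hNΓ _) ?_ ?_
      · refine tendsto_inv_nhdsGT_zero.comp (tendsto_nhdsWithin_iff.2
          ⟨by simpa using hNZ.norm, Eventually.of_forall fun n => ?_⟩)
        exact norm_pos_iff.2 (hZ' _).2
      · have h0 := (hasStrictFDerivAt_exp_zero (𝕂 := ℝ) (𝔸 := A)).hasFDerivAt.hasFDerivWithinAt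
          (s := Set.univ) |>.lim (l := atTop) (c := fun n => ‖N (Z (φ n))‖⁻¹)
          (d := fun n => N (Z (φ n))) (v := X) hNZ
          (Eventually.of_forall fun _ => trivial) hlim
        simpa using h0
    have hNX : N X = X := by
      have hNu : ∀ n, N (u n) = u n := by
        intro n
        simp only [u, map_smul, hNN]
      refine tendsto_nhds_unique ((N.continuous.tendsto X).comp hlim) ?_
      refine hlim.congr fun n => ?_
      simp [hNu]
    have := hN0 X hXlie
    rw [hNX] at this
    rw [this] at hX
    simp at hX
  have h5 : ∀ᶠ a in map Ψ (𝓝 0), a ∈ Γ → ∃ Z, a = exp (M Z) * exp (S Z) := by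
    rw [eventually_map]
    filter_upwards [key] with Z hZ hΓZ
    refine ⟨Z, ?_⟩
    simp [hΨ, hZ hΓZ]
  rwa [hmap] at h5

/-- An orbit of a closed linear group that is not a null set is open. -/
theorem IsClosedUnitGroup.isOpen_orbit_of_measure_ne_zero [MeasurableSpace E] [BorelSpace E]
    (μ : Measure E) [μ.IsAddHaarMeasure] {Γ : Submonoid (E →L[ℝ] E)} (hΓ : IsClosedUnitGroup Γ)
    {ξ : E} (hpos : μ ((fun a : E →L[ℝ] E => a ξ) '' (Γ : Set (E →L[ℝ] E))) ≠ 0) :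
    IsOpen ((fun a : E →L[ℝ] E => a ξ) '' (Γ : Set (E →L[ℝ] E))) := by
  set ev : (E →L[ℝ] E) →ₗ[ℝ] E :=
    (ContinuousLinearMap.apply ℝ E ξ).toLinearMap
  set U : Submodule ℝ E := hΓ.lie.map ev
  by_cases hUtop : U = ⊤
  · refine hΓ.isOpen_orbit fun y => ?_
    have : y ∈ U := hUtop ▸ Submodule.mem_top
    exact this
  exfalso
  apply hpos
  obtain ⟨P, hP⟩ := hΓ.lie.subtype.exists_leftInverse_of_injective
    (LinearMap.ker_eq_bot.2 hΓ.lie.injective_subtype)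
  have hP' : ∀ Z (hZ : Z ∈ hΓ.lie), (P Z : E →L[ℝ] E) = Z := fun Z hZ => by
    have := LinearMap.congr_fun hP ⟨Z, hZ⟩
    exact congrArg Subtype.val this
  obtain ⟨q, hq⟩ := U.subtype.exists_leftInverse_of_injective
    (LinearMap.ker_eq_bot.2 U.injective_subtype)
  have hq' : ∀ y (hy : y ∈ U), (q y : E) = y := fun y hy => by
    have := LinearMap.congr_fun hq ⟨y, hy⟩
    exact congrArg Subtype.val this
  obtain ⟨σ, hσ⟩ := (ev.submoduleMap hΓ.lie).exists_rightInverse_of_surjective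
    (LinearMap.range_eq_top.2 (ev.submoduleMap_surjective hΓ.lie))
  have hσ' : ∀ y : U, (σ y : E →L[ℝ] E) ξ = y := fun y => by
    have := LinearMap.congr_fun hσ y
    exact congrArg Subtype.val this
  -- Project to `U`, the image of the Lie algebra at `ξ`, then lift to the Lie algebra.
  -- Parametrizing by `E` keeps source and target of `y ↦ exp (L y) ξ` equal, as the Sard-type lemma
  -- below requires.
  set L : E →L[ℝ] (E →L[ℝ] E) := LinearMap.toContinuousLinearMap (hΓ.lie.subtype ∘ₗ σ ∘ₗ q)
  have hLlie : ∀ y, L y ∈ hΓ.lie := fun y => (σ (q y)).2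
  have hLξ : ∀ y ∈ U, (L y) ξ = y := fun y hy => by
    change (σ (q y) : E →L[ℝ] E) ξ = y
    rw [hσ', hq' y hy]
  -- As `U ≠ E`, the projection `q` has a kernel; `y₀` will lie in the kernel of every derivative of
  -- `y ↦ exp (L y) ξ`.
  obtain ⟨y₀, hy₀, hLy₀⟩ : ∃ y : E, y ≠ 0 ∧ L y = 0 := by
    obtain ⟨y, hy⟩ : ∃ y, y ∉ U := by
      by_contra! h
      exact hUtop (eq_top_iff.2 fun y _ => h y)
    refine ⟨y - q y, fun h => hy ?_, ?_⟩
    · rw [sub_eq_zero.1 h]; exact (q y).2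
    · change ((σ (q (y - q y)) : hΓ.lie) : E →L[ℝ] E) = 0
      have : q (y - q y) = 0 := by
        apply Subtype.ext
        rw [map_sub]
        simp [hq' _ (q y).2]
      rw [this, map_zero]; rfl
  set Pc : (E →L[ℝ] E) →L[ℝ] (E →L[ℝ] E) := LinearMap.toContinuousLinearMap
    (hΓ.lie.subtype ∘ₗ P)
  have hPlie : ∀ Z, Pc Z ∈ hΓ.lie := fun Z => (P Z).2
  set M : (E →L[ℝ] E) →L[ℝ] (E →L[ℝ] E) := L ∘L (ContinuousLinearMap.apply ℝ E ξ) ∘L Pc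
  set S : (E →L[ℝ] E) →L[ℝ] (E →L[ℝ] E) := Pc - M
  have hMapp : ∀ Z, M Z = L (Pc Z ξ) := fun Z => rfl
  have hM : ∀ Z, M Z ∈ hΓ.lie := fun Z => hLlie _
  have hS : ∀ Z, S Z ∈ hΓ.lie := fun Z => hΓ.lie.sub_mem (hPlie Z) (hM Z)
  have hMS : ∀ Z ∈ hΓ.lie, M Z + S Z = Z := fun Z hZ => by
    change M Z + (Pc Z - M Z) = Z
    rw [add_sub_cancel]
    exact hP' Z hZ
  -- `S Z` annihilates `ξ`, so only the constant term of the exponential series acts.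
  have hSξ : ∀ Z, exp (S Z) ξ = ξ := by
    intro Z
    have h0 : (S Z) ξ = 0 := by
      change (Pc Z - M Z) ξ = 0
      rw [sub_apply, hMapp, hLξ (Pc Z ξ) ⟨Pc Z, hPlie Z, rfl⟩, sub_self]
    let := NormedAlgebra.restrictScalars ℚ ℝ (E →L[ℝ] E)
    have h1 := (exp_series_hasSum_exp' (𝕂 := ℝ) (S Z)).mapL (ContinuousLinearMap.apply ℝ E ξ)
    have h2 : ∀ n : ℕ, n ≠ 0 →
        (ContinuousLinearMap.apply ℝ E ξ) (((n.factorial : ℝ)⁻¹) • (S Z) ^ n) = 0 := by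
      intro n hn
      obtain ⟨m, rfl⟩ := Nat.exists_eq_succ_of_ne_zero hn
      simp [pow_succ, h0]
    have h3 := hasSum_single 0 h2
    have h4 := h1.unique h3
    simpa using h4
  obtain ⟨W, hW, hWo, hW1⟩ := eventually_nhds_iff.1 (hΓ.eventually_mem_exp_mul_exp M S hM hS hMS)
  have hnull : μ ((fun y : E => exp (L y) ξ) '' Set.univ) = 0 := by
    have hd : ∀ y, DifferentiableAt ℝ (exp : (E →L[ℝ] E) → (E →L[ℝ] E)) y := fun y =>
      (exp_analytic (𝕂 := ℝ) y).differentiableAt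
    refine addHaar_image_eq_zero_of_det_fderivWithin_eq_zero μ
      (f' := fun y => (ContinuousLinearMap.apply ℝ E ξ) ∘L (fderiv ℝ exp (L y)) ∘L L) ?_ ?_
    · intro y _
      exact ((ContinuousLinearMap.apply ℝ E ξ).hasFDerivAt.comp y
        ((hd (L y)).hasFDerivAt.comp y L.hasFDerivAt)).hasFDerivWithinAt
    · intro y _
      rw [ContinuousLinearMap.det, LinearMap.det_eq_zero_iff_ker_ne_bot, Submodule.ne_bot_iff]
      refine ⟨y₀, ?_, hy₀⟩
      simp [hLy₀]
  choose! inv hinvΓ hinv1 hinv2 using hΓ.inv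
  -- Lindelöf: countably many translates `g W` of the neighbourhood `W` of `1` cover `Γ`, so the
  -- orbit lies in countably many linear images of the null set.
  obtain ⟨T, hTΓ, hTc, hT⟩ := TopologicalSpace.isOpen_biUnion_countable
    (Γ : Set (E →L[ℝ] E)) (fun g => {a | inv g * a ∈ W})
    (fun g _ => hWo.preimage (continuous_const.mul continuous_id))
  refine measure_mono_null (t := ⋃ g ∈ T, g '' ((fun y : E => exp (L y) ξ) '' Set.univ)) ?_ ?_
  · rintro _ ⟨a, ha, rfl⟩
    have : a ∈ ⋃ g ∈ (Γ : Set (E →L[ℝ] E)), {a | inv g * a ∈ W} := by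
      simp only [Set.mem_iUnion]
      exact ⟨a, ha, by simpa [hinv2 a ha] using hW1⟩
    rw [← hT] at this
    simp only [Set.mem_iUnion] at this
    obtain ⟨g, hg, hga⟩ := this
    obtain ⟨Z, hZ⟩ := hW _ hga (Γ.mul_mem (hinvΓ g (hTΓ hg)) ha)
    simp only [Set.mem_iUnion]
    refine ⟨g, hg, exp (L (Pc Z ξ)) ξ, ⟨Pc Z ξ, trivial, rfl⟩, ?_⟩
    have h1 : a = g * (exp (M Z) * exp (S Z)) := by
      rw [← hZ, ← mul_assoc, hinv1 g (hTΓ hg), one_mul]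
    change g (exp (M Z) ξ) = a ξ
    rw [h1, mul_apply_eq_comp, mul_apply_eq_comp, hSξ]
  · rw [measure_biUnion_null_iff hTc]
    intro g _
    rw [Measure.addHaar_image_continuousLinearMap, hnull, mul_zero]

end MatrixLieGroups

/-! ### The dual action and its effect on Lebesgue measure -/

section DualAction

variable {d : ℕ} {H : Subgroup (GL (Fin d) ℝ)}

/-- The linear map `ξ ↦ hᵀ ξ` of the dual action. -/
noncomputable def dualAct (h : H) : Euc d →L[ℝ] Euc d := matAct (mat h).transpose

theorem dualAct_one (ξ : Euc d) : dualAct (1 : H) ξ = ξ := by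
  rw [dualAct, mat_one, Matrix.transpose_one, matAct_one]

/-- Transposition reverses products, so this is a right action. That is why left Haar measure makes
orbit integrals invariant. -/
theorem dualAct_mul (h g : H) (ξ : Euc d) : dualAct (h * g) ξ = dualAct g (dualAct h ξ) := by
  rw [dualAct, mat_mul, Matrix.transpose_mul, matAct_mul]; rfl

theorem dualAct_inv_dualAct (h : H) (ξ : Euc d) : dualAct h⁻¹ (dualAct h ξ) = ξ := by
  rw [← dualAct_mul, mul_inv_cancel, dualAct_one]

theorem dualAct_dualAct_inv (h : H) (ξ : Euc d) : dualAct h (dualAct h⁻¹ ξ) = ξ := by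
  rw [← dualAct_mul, inv_mul_cancel, dualAct_one]

theorem inner_matAct (A : Matrix (Fin d) (Fin d) ℝ) (x y : Euc d) :
    inner ℝ (matAct A x) y = inner ℝ x (matAct A.transpose y) := by
  have : matAct A.transpose = ContinuousLinearMap.adjoint (matAct A) := by
    rw [matAct, ← Matrix.conjTranspose_eq_transpose_of_trivial]
    exact map_star (Matrix.toEuclideanCLM (n := Fin d) (𝕜 := ℝ)) A
  rw [this, ContinuousLinearMap.adjoint_inner_right]

theorem abs_det_pos (h : H) : 0 < |(mat h).det| := abs_pos.2 (mat_det_ne_zero h)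

theorem mat_det_inv (h : H) : (mat h⁻¹).det = ((mat h).det)⁻¹ := by
  have h1 := congrArg Matrix.det (mat_inv_mul h)
  rw [Matrix.det_mul, Matrix.det_one] at h1
  exact eq_inv_of_mul_eq_one_left h1

theorem map_matAct_volume {A : Matrix (Fin d) (Fin d) ℝ} (hA : A.det ≠ 0) :
    Measure.map (matAct A) (volume : Measure (Euc d)) = ENNReal.ofReal |A.det⁻¹| • volume := by
  have := Measure.map_linearMap_addHaar_eq_smul_addHaar (volume : Measure (Euc d))
    (f := (matAct A : Euc d →ₗ[ℝ] Euc d)) (by rwa [det_matAct])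
  rw [det_matAct] at this
  exact this

theorem map_dualAct_volume (h : H) :
    Measure.map (dualAct h) (volume : Measure (Euc d))
      = ENNReal.ofReal |(mat h).det⁻¹| • volume := by
  rw [dualAct, map_matAct_volume (by rw [Matrix.det_transpose]; exact mat_det_ne_zero h),
    Matrix.det_transpose]

theorem integral_comp_matAct {F : Type*} [NormedAddCommGroup F] [NormedSpace ℝ F]
    {A : Matrix (Fin d) (Fin d) ℝ} (hA : A.det ≠ 0) (f : Euc d → F) :
    ∫ x, f (matAct A x) = |A.det|⁻¹ • ∫ x, f x := by
  have hdet : LinearMap.det (matAct A : Euc d →ₗ[ℝ] Euc d) ≠ 0 := by rwa [det_matAct]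
  have he : MeasurableEmbedding (matAct A) :=
    ((matAct A).toContinuousLinearEquivOfDetNeZero hdet).toHomeomorph.measurableEmbedding
  rw [← he.integral_map, map_matAct_volume hA, integral_smul_measure,
    ENNReal.toReal_ofReal (abs_nonneg _), abs_inv]

theorem lintegral_comp_dualAct (h : H) {f : Euc d → ℝ≥0∞} (hf : Measurable f) :
    ∫⁻ ξ, f (dualAct h ξ) = ENNReal.ofReal |(mat h).det⁻¹| * ∫⁻ ξ, f ξ := by
  rw [← lintegral_map hf (dualAct h).continuous.measurable, map_dualAct_volume,
    lintegral_smul_measure, smul_eq_mul]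

theorem quasiMeasurePreserving_dualAct (h : H) :
    Measure.QuasiMeasurePreserving (dualAct h) (volume : Measure (Euc d)) volume := by
  refine ⟨(dualAct h).continuous.measurable, ?_⟩
  rw [map_dualAct_volume]
  exact Measure.smul_absolutelyContinuous

end DualAction

/-! ### Weighted composition operators on `L²` -/

section WeightedComposition

variable {d : ℕ} {m : Euc d → ℂ} {τ : Euc d → Euc d} {k : ℝ≥0∞} {r : ℝ}

theorem eLpNorm_weighted_comp_le (hτ : Measurable τ)
    (hmap : Measure.map τ volume = k • (volume : Measure (Euc d))) (hm : ∀ y, ‖m y‖ ≤ r)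
    {F : Euc d → ℂ} (hF : AEStronglyMeasurable F volume) :
    eLpNorm (fun y => m y * F (τ y)) 2 volume
      ≤ ENNReal.ofReal r * (k ^ (1 / 2 : ℝ) * eLpNorm F 2 volume) := by
  have hF' : AEStronglyMeasurable F (Measure.map τ volume) := by
    rw [hmap]; exact hF.mono_ac Measure.smul_absolutelyContinuous
  have h1 : eLpNorm (F ∘ τ) 2 volume = k ^ (1 / 2 : ℝ) * eLpNorm F 2 volume := by
    rw [← eLpNorm_map_measure hF' hτ.aemeasurable, hmap,
      eLpNorm_smul_measure_of_ne_top (by simp), smul_eq_mul]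
    simp
  rw [← h1]
  refine eLpNorm_le_mul_eLpNorm_of_ae_le_mul (Filter.Eventually.of_forall fun y => ?_) 2
  rw [norm_mul]
  exact mul_le_mul_of_nonneg_right (hm y) (norm_nonneg _)

theorem memLp_weighted_comp (hτ : Measurable τ)
    (hmap : Measure.map τ volume = k • (volume : Measure (Euc d))) (hk : k ≠ ⊤)
    (hmm : Measurable m) (hm : ∀ y, ‖m y‖ ≤ r)
    {F : Euc d → ℂ} (hF : MemLp F 2 volume) : MemLp (fun y => m y * F (τ y)) 2 volume := by
  refine ⟨hmm.aestronglyMeasurable.mul (hF.1.comp_quasiMeasurePreserving ⟨hτ, ?_⟩), ?_⟩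
  · rw [hmap]; exact Measure.smul_absolutelyContinuous
  · refine (eLpNorm_weighted_comp_le hτ hmap hm hF.1).trans_lt ?_
    exact ENNReal.mul_lt_top ENNReal.ofReal_lt_top
      (ENNReal.mul_lt_top (ENNReal.rpow_lt_top_of_nonneg (by norm_num) hk) hF.2)

/-- Gives continuity of both forms of the representation, which are plain maps of `L²`, so that
identities extend from Schwartz functions by density. -/
theorem continuous_weighted_comp (hτ : Measurable τ)
    (hmap : Measure.map τ volume = k • (volume : Measure (Euc d))) (hk : k ≠ ⊤)
    (hm : ∀ y, ‖m y‖ ≤ r) {T : L2 d → L2 d}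
    (hT : ∀ f, T f =ᵐ[volume] fun y => m y * f (τ y)) : Continuous T := by
  have hC : ENNReal.ofReal r * k ^ (1 / 2 : ℝ) ≠ ⊤ :=
    (ENNReal.mul_lt_top ENNReal.ofReal_lt_top
      (ENNReal.rpow_lt_top_of_nonneg (by norm_num) hk)).ne
  have : LipschitzWith (ENNReal.ofReal r * k ^ (1 / 2 : ℝ)).toNNReal T := by
    intro f g
    rw [ENNReal.coe_toNNReal hC, Lp.edist_def, Lp.edist_def, mul_assoc]
    have h1 := eLpNorm_weighted_comp_le hτ hmap hm
      ((Lp.aestronglyMeasurable f).sub (Lp.aestronglyMeasurable g))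
    refine le_trans (le_of_eq (eLpNorm_congr_ae ?_)) h1
    filter_upwards [hT f, hT g] with y h2 h3
    rw [Pi.sub_apply, h2, h3, Pi.sub_apply, mul_sub]
  exact this.continuous

end WeightedComposition

/-! ### The quasi-regular representation on the Fourier side -/

section FourierQuasiRegular

variable {d : ℕ} {H : Subgroup (GL (Fin d) ℝ)}

theorem coeFn_quasiReg (g : AffGroup H) (f : L2 d) :
    quasiReg g f =ᵐ[volume] quasiRegFun g f := MemLp.coeFn_toLp _

/-- The map `y ↦ h⁻¹ (y - x)`. -/
noncomputable def affInv (g : AffGroup H) (y : Euc d) : Euc d :=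
  matAct (mat g.dil⁻¹) (y - g.trans)

theorem measurable_affInv (g : AffGroup H) : Measurable (affInv g) :=
  ((matAct (mat g.dil⁻¹)).continuous.comp (continuous_id.sub continuous_const)).measurable

theorem map_affInv_volume (g : AffGroup H) :
    Measure.map (affInv g) (volume : Measure (Euc d))
      = ENNReal.ofReal |(mat g.dil⁻¹).det⁻¹| • volume := by
  have h1 : affInv g = matAct (mat g.dil⁻¹) ∘ (fun y => y - g.trans) := rfl
  rw [h1, ← Measure.map_map (matAct (mat g.dil⁻¹)).continuous.measurable
    (measurable_sub_const g.trans), (measurePreserving_sub_right volume g.trans).map_eq,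
    map_matAct_volume (mat_det_ne_zero _)]

theorem continuous_quasiReg (g : AffGroup H) : Continuous (quasiReg g : L2 d → L2 d) :=
  continuous_weighted_comp (τ := affInv g) (m := fun _ =>
    ((|(mat g.dil).det| ^ (-(1 / 2) : ℝ) : ℝ) : ℂ))
    (measurable_affInv g) (map_affInv_volume g) ENNReal.ofReal_ne_top (fun _ => le_rfl)
    (fun f => coeFn_quasiReg g f)

/-- The factor `|det h|^{1/2} e^{-2πi⟨x, ξ⟩}`. -/
noncomputable def dualFactor (g : AffGroup H) (ξ : Euc d) : ℂ :=
  ((|(mat g.dil).det| ^ (1 / 2 : ℝ) : ℝ) : ℂ) *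
    Complex.exp (((-2 * Real.pi * inner ℝ g.trans ξ : ℝ) : ℂ) * Complex.I)

theorem continuous_dualFactor (g : AffGroup H) : Continuous (dualFactor g) := by
  unfold dualFactor
  fun_prop

theorem norm_dualFactor (g : AffGroup H) (ξ : Euc d) :
    ‖dualFactor g ξ‖ = |(mat g.dil).det| ^ (1 / 2 : ℝ) := by
  rw [dualFactor, norm_mul, Complex.norm_exp_ofReal_mul_I, mul_one, Complex.norm_real,
    Real.norm_of_nonneg (by positivity)]

/-- The quasi-regular representation on the Fourier side:
`ξ ↦ |det h|^{1/2} e^{-2πi⟨x, ξ⟩} F(hᵀ ξ)`. -/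
noncomputable def dualReg (g : AffGroup H) (F : L2 d) : L2 d :=
  (memLp_weighted_comp (m := dualFactor g) (dualAct g.dil).continuous.measurable
    (map_dualAct_volume g.dil) ENNReal.ofReal_ne_top (continuous_dualFactor g).measurable
    (fun ξ => (norm_dualFactor g ξ).le) (Lp.memLp F)).toLp

theorem coeFn_dualReg (g : AffGroup H) (F : L2 d) :
    dualReg g F =ᵐ[volume] fun ξ => dualFactor g ξ * F (dualAct g.dil ξ) := MemLp.coeFn_toLp _

theorem continuous_dualReg (g : AffGroup H) : Continuous (dualReg g : L2 d → L2 d) :=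
  continuous_weighted_comp (dualAct g.dil).continuous.measurable
    (map_dualAct_volume g.dil) ENNReal.ofReal_ne_top
    (fun ξ => (norm_dualFactor g ξ).le) (fun F => coeFn_dualReg g F)

/-- Substitute `y = h z + x`: the Jacobian `|det h|` turns the factor `|det h|^{-1/2}` into `|det
h|^{1/2}`. Without integrability the identity still holds, for the default value of the integral. -/
theorem fourier_quasiRegFun (g : AffGroup H) (f : Euc d → ℂ) (ξ : Euc d) :
    𝓕 (quasiRegFun g f) ξ = dualFactor g ξ * 𝓕 f (dualAct g.dil ξ) := by
  rw [Real.fourier_eq', Real.fourier_eq']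
  have hA : (mat g.dil⁻¹).det ≠ 0 := mat_det_ne_zero _
  have hpos := abs_det_pos g.dil
  set c : ℂ := ((|(mat g.dil).det| ^ (-(1 / 2) : ℝ) : ℝ) : ℂ)
  set G : Euc d → ℂ := fun z => Complex.exp
    (((-2 * Real.pi * inner ℝ (matAct (mat g.dil) z + g.trans) ξ : ℝ) : ℂ) * Complex.I) *
      (c * f z)
  have h1 : ∀ y, Complex.exp (((-2 * Real.pi * inner ℝ y ξ : ℝ) : ℂ) * Complex.I) •
      quasiRegFun g f y = G (matAct (mat g.dil⁻¹) (y - g.trans)) := by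
    intro y
    have : matAct (mat g.dil) (matAct (mat g.dil⁻¹) (y - g.trans)) = y - g.trans := by
      rw [← matAct_mul, ← mat_mul, mul_inv_cancel, mat_one, matAct_one]
    simp only [G, this, sub_add_cancel, smul_eq_mul]
    rfl
  simp_rw [h1]
  rw [integral_sub_right_eq_self (fun y => G (matAct (mat g.dil⁻¹) y)) g.trans,
    integral_comp_matAct hA, mat_det_inv, abs_inv, inv_inv]
  have h2 : ∀ z, G z = (c * Complex.exp
      (((-2 * Real.pi * inner ℝ g.trans ξ : ℝ) : ℂ) * Complex.I)) *
      (Complex.exp (((-2 * Real.pi * inner ℝ z (dualAct g.dil ξ) : ℝ) : ℂ) * Complex.I) •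
        f z) := by
    intro z
    simp only [G, inner_add_left, inner_matAct, smul_eq_mul, dualAct]
    rw [mul_add, Complex.ofReal_add, add_mul, Complex.exp_add]
    ring
  simp_rw [h2]
  rw [integral_const_mul, Complex.real_smul, ← mul_assoc, ← mul_assoc, dualFactor]
  congr 2
  rw [← Complex.ofReal_mul]
  congr 1
  conv_lhs => rw [← Real.rpow_one |(mat g.dil).det|]
  rw [← Real.rpow_mul hpos.le, ← Real.rpow_add hpos]
  norm_num

/-- The Fourier transform intertwines the quasi-regular representation with its dual form. -/
theorem fourier_quasiReg (g : AffGroup H) (f : L2 d) :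
    (𝓕 (quasiReg g f) : L2 d) = dualReg g (𝓕 f) := by
  refine DenseRange.induction_on (p := fun f : L2 d => (𝓕 (quasiReg g f) : L2 d) = dualReg g (𝓕 f))
    (SchwartzMap.denseRange_toLpCLM (E := Euc d) (F := ℂ) (p := 2) (μ := volume)
      ENNReal.ofNat_ne_top) f ?_ ?_
  · exact isClosed_eq
      ((FourierTransform.continuous_fourier (E := L2 d)).comp (continuous_quasiReg g))
      ((continuous_dualReg g).comp (FourierTransform.continuous_fourier (E := L2 d)))
  · intro φ
    change (𝓕 (quasiReg g (φ.toLp 2)) : L2 d) = dualReg g (𝓕 (φ.toLp 2))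
    have hdet : LinearMap.det (matAct (mat g.dil⁻¹) : Euc d →ₗ[ℝ] Euc d) ≠ 0 := by
      rw [det_matAct]; exact mat_det_ne_zero _
    set e := (matAct (mat g.dil⁻¹)).toContinuousLinearEquivOfDetNeZero hdet
    set φ' : SchwartzMap (Euc d) ℂ := ((|(mat g.dil).det| ^ (-(1 / 2) : ℝ) : ℝ) : ℂ) •
      (SchwartzMap.compSubConstCLM ℂ g.trans (SchwartzMap.compCLMOfContinuousLinearEquiv ℂ e φ))
    have hφ' : (φ' : Euc d → ℂ) = quasiRegFun g φ := by
      ext y; rfl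
    have h1 : quasiReg g (φ.toLp 2) = φ'.toLp 2 := by
      refine Lp.ext ?_
      have hq : Measure.QuasiMeasurePreserving (affInv g) (volume : Measure (Euc d)) volume :=
        ⟨measurable_affInv g, by
          rw [map_affInv_volume]; exact Measure.smul_absolutelyContinuous⟩
      filter_upwards [coeFn_quasiReg g (φ.toLp 2), φ'.coeFn_toLp 2,
        hq.ae_eq_comp (φ.coeFn_toLp 2)] with y hy1 hy2 hy3
      rw [hy1, hy2, hφ']
      change _ * _ = _ * _
      congr 1
    rw [h1, SchwartzMap.toLp_fourier_eq, SchwartzMap.toLp_fourier_eq]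
    refine Lp.ext ?_
    filter_upwards [coeFn_dualReg g ((𝓕 φ).toLp 2), (𝓕 φ').coeFn_toLp 2,
      (quasiMeasurePreserving_dualAct g.dil).ae_eq_comp ((𝓕 φ).coeFn_toLp 2)] with ξ h2 h3 h4
    rw [h2, h3, SchwartzMap.fourier_coe, hφ', fourier_quasiRegFun]
    congr 1
    rw [← SchwartzMap.fourier_coe]
    exact h4.symm

/-- The wavelet transform is, up to a factor, an inverse Fourier transform in the translation
variable. -/
theorem wavelet_eq_fourierInv (ψ f : L2 d) {P Q : Euc d → ℂ} (hP : (𝓕 ψ : L2 d) =ᵐ[volume] P)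
    (hQ : (𝓕 f : L2 d) =ᵐ[volume] Q) (g : AffGroup H) :
    wavelet ψ f g = ((|(mat g.dil).det| ^ (1 / 2 : ℝ) : ℝ) : ℂ) *
      𝓕⁻ (fun ξ => Q ξ * starRingEnd ℂ (P (dualAct g.dil ξ))) g.trans := by
  rw [wavelet, ← Lp.inner_fourier_eq, fourier_quasiReg, L2.inner_def, Real.fourierInv_eq',
    ← integral_const_mul]
  refine integral_congr_ae ?_
  filter_upwards [coeFn_dualReg g (𝓕 ψ), hQ,
    (quasiMeasurePreserving_dualAct g.dil).ae_eq_comp hP] with ξ h1 h2 h3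
  have h3' : (𝓕 ψ : L2 d) (dualAct g.dil ξ) = P (dualAct g.dil ξ) := h3
  rw [h1, h2, h3']
  simp only [dualFactor, RCLike.inner_apply, map_mul, Complex.conj_ofReal, ← Complex.exp_conj,
    Complex.conj_I, smul_eq_mul]
  rw [real_inner_comm ξ g.trans]
  have : ((-2 * Real.pi * inner ℝ ξ g.trans : ℝ) : ℂ) * -Complex.I
    = ((2 * Real.pi * inner ℝ ξ g.trans : ℝ) : ℂ) * Complex.I := by push_cast; ring
  rw [this]
  ring

end FourierQuasiRegular

/-! ### Plancherel for integrable functions -/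

section Plancherel

variable {d : ℕ}

theorem integral_smul_fourierInv_eq {F G : Euc d → ℂ} (hF : Integrable F) (hG : Integrable G) :
    ∫ x, G x • 𝓕⁻ F x = ∫ ξ, 𝓕⁻ G ξ • F ξ := by
  have h := VectorFourier.integral_fourierIntegral_smul_eq_flip (L := -innerₗ (Euc d))
    (μ := volume) (ν := volume) Real.continuous_fourierChar (by
      simp only [LinearMap.neg_apply, innerₗ_apply_apply]; fun_prop) hG hF
  have hflip : (-innerₗ (Euc d)).flip = -innerₗ (Euc d) := by
    ext x y; simp [real_inner_comm]
  rw [hflip] at h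
  exact h.symm

/-- If the inverse Fourier transform of an integrable function is square-integrable, then it has
the same norm as the function. -/
theorem eLpNorm_eq_eLpNorm_fourierInv {F : Euc d → ℂ} (hF : Integrable F)
    (hF2 : MemLp (𝓕⁻ F) 2 volume) : eLpNorm F 2 volume = eLpNorm (𝓕⁻ F) 2 volume := by
  set u : L2 d := hF2.toLp
  -- `F` is not yet known to be in `L²`, so it is compared with `𝓕 u` by pairing with test
  -- functions.
  have key : ∀ᵐ ξ, F ξ = (𝓕 u : L2 d) ξ := by
    refine ae_eq_of_integral_contDiff_smul_eq hF.locallyIntegrable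
      ((Lp.memLp (𝓕 u : L2 d)).locallyIntegrable (by norm_num)) fun g hg hgc => ?_
    have hg₁ : HasCompactSupport (Complex.ofRealCLM ∘ g) := hgc.comp_left rfl
    have hg₂ : ContDiff ℝ ∞ (Complex.ofRealCLM ∘ g) := by fun_prop
    set φ : SchwartzMap (Euc d) ℂ := hg₁.toSchwartzMap hg₂
    have hφ : ∀ x, φ x = (g x : ℂ) := fun x => rfl
    have h1 : ∫ ξ, g ξ • (𝓕 u : L2 d) ξ = ∫ x, (𝓕 φ) x • u x := by
      have := DFunLike.congr_fun (Lp.fourier_toTemperedDistribution_eq u) φ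
      rw [TemperedDistribution.fourier_apply, Lp.toTemperedDistribution_apply,
        Lp.toTemperedDistribution_apply] at this
      rw [this]
      simp [hφ]
    have h2 : ∫ x, (𝓕 φ) x • u x = ∫ x, (𝓕 φ) x • 𝓕⁻ F x := by
      refine integral_congr_ae ?_
      filter_upwards [hF2.coeFn_toLp] with x hx
      rw [hx]
    have h3 : 𝓕⁻ ((𝓕 φ : SchwartzMap (Euc d) ℂ) : Euc d → ℂ) = φ := by
      rw [← SchwartzMap.fourierInv_coe, FourierTransform.fourierInv_fourier_eq]
    rw [h1, h2, integral_smul_fourierInv_eq hF (𝓕 φ).integrable, h3]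
    simp [hφ]
  rw [eLpNorm_congr_ae key]
  have h1 : ‖(𝓕 u : L2 d)‖ = ‖u‖ := Lp.norm_fourier_eq u
  rw [Lp.norm_def, Lp.norm_def, ENNReal.toReal_eq_toReal_iff' (Lp.eLpNorm_ne_top _)
    (Lp.eLpNorm_ne_top _)] at h1
  rw [h1]
  exact eLpNorm_congr_ae hF2.coeFn_toLp

/-- If the right side is infinite there is nothing to prove; this form serves products of two `L²`
functions, known only to be in `L¹`. -/
theorem lintegral_sq_le_of_fourierInv {F : Euc d → ℂ} (hF : Integrable F) :
    ∫⁻ ξ, ‖F ξ‖ₑ ^ 2 ≤ ∫⁻ x, ‖𝓕⁻ F x‖ₑ ^ 2 := by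
  have hsq : ∀ G : Euc d → ℂ, eLpNorm G 2 volume ^ 2 = ∫⁻ x, ‖G x‖ₑ ^ 2 := fun G => by
    rw [eLpNorm_eq_lintegral_rpow_enorm_toReal (by norm_num) (by norm_num), ← ENNReal.rpow_natCast,
      ← ENNReal.rpow_mul]
    simp
  have hmeas : AEStronglyMeasurable (𝓕⁻ F) volume := by
    have : Continuous (𝓕⁻ F) := VectorFourier.fourierIntegral_continuous
      Real.continuous_fourierChar (by
        simp only [LinearMap.neg_apply, innerₗ_apply_apply]; fun_prop) hF
    exact this.aestronglyMeasurable
  by_cases h : eLpNorm (𝓕⁻ F) 2 volume = ⊤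
  · rw [← hsq (𝓕⁻ F), h]; simp
  · rw [← hsq, ← hsq, eLpNorm_eq_eLpNorm_fourierInv hF ⟨hmeas, lt_top_iff_ne_top.2 h⟩]

end Plancherel

/-! ### Topology of closed matrix groups and of their orbits -/

section MatrixGroupTopology

open Filter Topology

variable {d : ℕ}

instance matrix_secondCountableTopology :
    SecondCountableTopology (Matrix (Fin d) (Fin d) ℝ) :=
  inferInstanceAs (SecondCountableTopology (Fin d → Fin d → ℝ))

instance matrix_locallyCompactSpace : LocallyCompactSpace (Matrix (Fin d) (Fin d) ℝ) :=
  inferInstanceAs (LocallyCompactSpace (Fin d → Fin d → ℝ))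

instance generalLinearGroup_secondCountableTopology :
    SecondCountableTopology (GL (Fin d) ℝ) := by
  have : SecondCountableTopology (Matrix (Fin d) (Fin d) ℝ)ᵐᵒᵖ :=
    MulOpposite.opHomeomorph.symm.secondCountableTopology
  exact Units.isEmbedding_embedProduct.secondCountableTopology

instance generalLinearGroup_locallyCompactSpace : LocallyCompactSpace (GL (Fin d) ℝ) :=
  inferInstanceAs (LocallyCompactSpace (Matrix (Fin d) (Fin d) ℝ)ˣ)

variable {H : Subgroup (GL (Fin d) ℝ)}

theorem locallyCompactSpace_of_isClosed (hH : IsClosed (H : Set (GL (Fin d) ℝ))) :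
    LocallyCompactSpace H := hH.isClosedEmbedding_subtypeVal.locallyCompactSpace

theorem sigmaCompactSpace_of_isClosed (hH : IsClosed (H : Set (GL (Fin d) ℝ))) :
    SigmaCompactSpace H := by
  have := locallyCompactSpace_of_isClosed hH
  have : SecondCountableTopology H := TopologicalSpace.Subtype.secondCountableTopology _
  exact sigmaCompactSpace_of_locallyCompact_secondCountable

theorem continuous_mat : Continuous (mat : H → Matrix (Fin d) (Fin d) ℝ) :=
  Units.continuous_val.comp continuous_subtype_val

theorem continuous_matAct : Continuous (matAct : Matrix (Fin d) (Fin d) ℝ → Euc d →L[ℝ] Euc d) :=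
  LinearMap.continuous_of_finiteDimensional
    (Matrix.toEuclideanCLM (n := Fin d) (𝕜 := ℝ)).toAlgEquiv.toLinearMap

theorem continuous_dualAct : Continuous (dualAct : H → Euc d →L[ℝ] Euc d) :=
  continuous_matAct.comp continuous_mat.matrix_transpose

theorem continuous_dualAct_apply : Continuous fun p : H × Euc d => dualAct p.1 p.2 :=
  (continuous_dualAct.comp continuous_fst).clm_apply continuous_snd

theorem measurable_dualAct_apply : Measurable fun p : H × Euc d => dualAct p.1 p.2 :=
  continuous_dualAct_apply.measurable

/-- The group of linear maps `ξ ↦ hᵀ ξ`, `h ∈ H`. -/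
noncomputable def dualGroup (H : Subgroup (GL (Fin d) ℝ)) : Submonoid (Euc d →L[ℝ] Euc d) where
  carrier := Set.range (dualAct : H → Euc d →L[ℝ] Euc d)
  one_mem' := ⟨1, ContinuousLinearMap.ext fun ξ => dualAct_one ξ⟩
  mul_mem' := by
    rintro _ _ ⟨h, rfl⟩ ⟨g, rfl⟩
    exact ⟨g * h, ContinuousLinearMap.ext fun ξ => dualAct_mul g h ξ⟩

theorem image_dualGroup (ξ : Euc d) :
    (fun a : Euc d →L[ℝ] Euc d => a ξ) '' (dualGroup H : Set (Euc d →L[ℝ] Euc d))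
      = dualOrbit H ξ := by
  change (fun a : Euc d →L[ℝ] Euc d => a ξ) '' Set.range dualAct = _
  rw [← Set.range_comp]
  rfl

/-- The topology of `GL` controls a matrix and its inverse. At an invertible limit inversion is
continuous, so convergence of matrices is convergence in `GL`, where `H` is closed. -/
theorem isClosedUnitGroup_dualGroup (hH : IsClosed (H : Set (GL (Fin d) ℝ))) :
    IsClosedUnitGroup (dualGroup H) where
  inv := by
    rintro _ ⟨h, rfl⟩
    exact ⟨dualAct h⁻¹, ⟨h⁻¹, rfl⟩, ContinuousLinearMap.ext fun ξ => dualAct_dualAct_inv h ξ,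
      ContinuousLinearMap.ext fun ξ => dualAct_inv_dualAct h ξ⟩
  closed a ha hu := by
    obtain ⟨u, hu, hlim⟩ := mem_closure_iff_seq_limit.1 ha
    choose h hh using hu
    set e := Matrix.toEuclideanCLM (n := Fin d) (𝕜 := ℝ)
    have hcont : Continuous fun b : Euc d →L[ℝ] Euc d => (e.symm b).transpose :=
      Continuous.matrix_transpose (LinearMap.continuous_of_finiteDimensional
        e.symm.toAlgEquiv.toLinearMap)
    have hmat : ∀ n, (e.symm (u n)).transpose = mat (h n) := fun n => by
      rw [← hh n, dualAct, matAct, e.symm_apply_apply, Matrix.transpose_transpose]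
    set A := (e.symm a).transpose with hA
    have h1 : Tendsto (fun n => mat (h n)) atTop (𝓝 A) := by
      have := (hcont.tendsto a).comp hlim
      exact this.congr hmat
    have hAu : IsUnit A.det := by
      rw [hA, Matrix.det_transpose, ← Matrix.isUnit_iff_isUnit_det]
      exact hu.map e.symm
    have h2 : Tendsto (fun n => (mat (h n))⁻¹) atTop (𝓝 A⁻¹) := by
      refine Tendsto.comp (continuousAt_matrix_inv A ?_) h1
      rw [Ring.inverse_eq_inv']
      exact continuousAt_inv₀ hAu.ne_zero
    set U : GL (Fin d) ℝ := Matrix.GeneralLinearGroup.mk'' A hAu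
    have h3 : Tendsto (fun n => ((h n : GL (Fin d) ℝ))) atTop (𝓝 U) := by
      rw [Units.isEmbedding_embedProduct.tendsto_nhds_iff]
      refine Tendsto.prodMk_nhds h1 ((MulOpposite.continuous_op.tendsto _).comp ?_)
      have hU : ((U⁻¹ : GL (Fin d) ℝ) : Matrix (Fin d) (Fin d) ℝ) = A⁻¹ := by
        rw [Matrix.coe_units_inv]; rfl
      rw [hU]
      refine h2.congr fun n => ?_
      rw [Matrix.coe_units_inv]; rfl
    have h4 : U ∈ H := hH.mem_of_tendsto h3 (Eventually.of_forall fun n => (h n).2)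
    refine ⟨⟨U, h4⟩, ?_⟩
    change matAct A.transpose = a
    rw [hA, Matrix.transpose_transpose, matAct]
    exact e.apply_symm_apply a

theorem measurableSet_dualOrbit (hH : IsClosed (H : Set (GL (Fin d) ℝ))) (ξ : Euc d) :
    MeasurableSet (dualOrbit H ξ) := by
  have := sigmaCompactSpace_of_isClosed hH
  obtain ⟨K, hK, hKu⟩ := isSigmaCompact_range (X := H)
    (f := fun h => dualAct h ξ) (continuous_dualAct.clm_apply continuous_const)
  have : dualOrbit H ξ = ⋃ n, K n := hKu.symm
  rw [this]
  exact MeasurableSet.iUnion fun n => (hK n).measurableSet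

theorem isOpen_dualOrbit_of_volume_ne_zero (hH : IsClosed (H : Set (GL (Fin d) ℝ))) {ξ : Euc d}
    (h : volume (dualOrbit H ξ) ≠ 0) : IsOpen (dualOrbit H ξ) := by
  rw [← image_dualGroup] at h ⊢
  exact (isClosedUnitGroup_dualGroup hH).isOpen_orbit_of_measure_ne_zero volume h

end MatrixGroupTopology

/-! ### Ergodicity of the dual action -/

section Ergodicity

open Filter

variable {d : ℕ} {H : Subgroup (GL (Fin d) ℝ)}

theorem exists_L2_ne_zero_of_volume_ne_zero {C : Set (Euc d)} (hC : MeasurableSet C)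
    (hpos : volume C ≠ 0) : ∃ F : L2 d, F ≠ 0 ∧ ∀ᵐ ξ, ξ ∉ C → F ξ = 0 := by
  obtain ⟨n, hn⟩ : ∃ n : ℕ, volume (C ∩ Metric.closedBall 0 n) ≠ 0 := by
    by_contra! h
    refine hpos (measure_mono_null (t := ⋃ n : ℕ, C ∩ Metric.closedBall 0 n) ?_
      (measure_iUnion_null h))
    rw [← Set.inter_iUnion, Metric.iUnion_closedBall_nat, Set.inter_univ]
  have hm : MeasurableSet (C ∩ Metric.closedBall (0 : Euc d) n) :=
    hC.inter measurableSet_closedBall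
  have hfin : volume (C ∩ Metric.closedBall (0 : Euc d) n) ≠ ⊤ :=
    ((measure_mono Set.inter_subset_right).trans_lt measure_closedBall_lt_top).ne
  refine ⟨indicatorConstLp 2 hm hfin (1 : ℂ), fun h => hn ?_, ?_⟩
  · have := norm_indicatorConstLp (p := 2) (hs := hm) (hμs := hfin) (c := (1 : ℂ))
      (by norm_num) (by norm_num)
    rw [h, norm_zero, norm_one, one_mul, eq_comm,
      Real.rpow_eq_zero measureReal_nonneg (by norm_num)] at this
    exact (measureReal_eq_zero_iff hfin).1 this
  · filter_upwards [indicatorConstLp_coeFn (p := 2) (hs := hm) (hμs := hfin) (c := (1 : ℂ))]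
      with ξ hξ hξC
    rw [hξ, Set.indicator_of_notMem fun h => hξC h.1]

/-- The dual action of an irreducible quasi-regular representation is ergodic. -/
theorem QuasiRegIrreducible.null_or_conull (hirr : QuasiRegIrreducible H) {B : Set (Euc d)}
    (hB : MeasurableSet B) (hinv : ∀ (h : H) (ξ : Euc d), dualAct h ξ ∈ B ↔ ξ ∈ B) :
    volume B = 0 ∨ volume Bᶜ = 0 := by
  -- The subspace of `f` with `𝓕 f = 0` off `B` is written as a kernel, which makes it closed.
  set R : L2 d →L[ℂ] _ := LpToLpRestrictCLM (Euc d) ℂ ℂ volume 2 Bᶜ ∘L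
    (Lp.fourierTransformₗᵢ (Euc d) ℂ).toContinuousLinearEquiv.toContinuousLinearMap
  have hR : ∀ f : L2 d, f ∈ R.ker ↔ ∀ᵐ ξ, ξ ∉ B → (𝓕 f : L2 d) ξ = 0 := by
    intro f
    rw [LinearMap.mem_ker]
    change LpToLpRestrictCLM (Euc d) ℂ ℂ volume 2 Bᶜ (𝓕 f : L2 d) = 0 ↔ _
    have h0 := ae_restrict_iff' (μ := volume) hB.compl (p := fun ξ => (𝓕 f : L2 d) ξ = 0)
    simp only [Set.mem_compl_iff] at h0
    rw [Lp.eq_zero_iff_ae_eq_zero, ← h0]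
    have h1 := LpToLpRestrictCLM_coeFn ℂ Bᶜ (𝓕 f : L2 d)
    constructor
    · intro h; filter_upwards [h, h1] with ξ h2 h3; rw [← h3, h2]; rfl
    · intro h; filter_upwards [h, h1] with ξ h2 h3; rw [h3, h2]; rfl
  have hfi : ∀ F : L2 d, (𝓕 (𝓕⁻ F : L2 d) : L2 d) = F := fun F =>
    FourierTransform.fourier_fourierInv_eq F
  rcases hirr R.ker R.isClosed_ker (fun g f hf => by
    rw [hR] at hf ⊢
    rw [fourier_quasiReg]
    filter_upwards [coeFn_dualReg g (𝓕 f), (quasiMeasurePreserving_dualAct g.dil).ae hf]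
      with ξ h1 h2 h3
    rw [h1, h2 (fun h => h3 ((hinv _ _).1 h)), mul_zero]) with hK | hK
  · left
    by_contra hpos
    obtain ⟨F, hF0, hF⟩ := exists_L2_ne_zero_of_volume_ne_zero hB hpos
    have h1 : (𝓕⁻ F : L2 d) ∈ R.ker := by rw [hR, hfi]; exact hF
    rw [hK, Submodule.mem_bot] at h1
    apply hF0
    rw [← hfi F, h1]
    exact map_zero (Lp.fourierTransformₗᵢ (Euc d) ℂ)
  · right
    by_contra hpos
    obtain ⟨F, hF0, hF⟩ := exists_L2_ne_zero_of_volume_ne_zero hB.compl hpos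
    have h1 : (𝓕⁻ F : L2 d) ∈ R.ker := hK ▸ Submodule.mem_top
    rw [hR, hfi] at h1
    apply hF0
    rw [Lp.eq_zero_iff_ae_eq_zero]
    filter_upwards [hF, h1] with ξ h2 h3
    by_cases hξ : ξ ∈ B
    · exact h2 (fun h => h hξ)
    · exact h3 hξ

/-- The integral of `b` over the orbit of `ξ` under the dual action. -/
noncomputable def orbitIntegral (μH : Measure H) (b : Euc d → ℝ≥0∞) (ξ : Euc d) : ℝ≥0∞ :=
  ∫⁻ h, b (dualAct h ξ) ∂μH

theorem orbitIntegral_dualAct (μH : Measure H) [μH.IsMulLeftInvariant] (b : Euc d → ℝ≥0∞) (g : H)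
    (ξ : Euc d) : orbitIntegral μH b (dualAct g ξ) = orbitIntegral μH b ξ := by
  unfold orbitIntegral
  simp_rw [← dualAct_mul]
  exact lintegral_mul_left_eq_self (fun h => b (dualAct h ξ)) g

theorem measurable_orbitIntegral (μH : Measure H) [SFinite μH] {b : Euc d → ℝ≥0∞}
    (hb : Measurable b) : Measurable (orbitIntegral μH b) :=
  Measurable.lintegral_prod_left' (hb.comp measurable_dualAct_apply)

/-- An invariant measurable function has null or conull preimages by ergodicity, and countably many
measurable sets separate the points of `ℝ≥0∞`. -/
theorem QuasiRegIrreducible.exists_orbitIntegral_eq_const (hirr : QuasiRegIrreducible H)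
    (μH : Measure H) [μH.IsMulLeftInvariant] [SFinite μH] {b : Euc d → ℝ≥0∞}
    (hb : Measurable b) : ∃ c : ℝ≥0∞, ∀ᵐ ξ, orbitIntegral μH b ξ = c := by
  refine exists_eventuallyEq_const_of_forall_separating MeasurableSet fun U hU => ?_
  rcases hirr.null_or_conull (measurable_orbitIntegral μH hb hU) (fun h ξ => by
    rw [Set.mem_preimage, Set.mem_preimage, orbitIntegral_dualAct]) with h | h
  · right; exact measure_eq_zero_iff_ae_notMem.1 h
  · left; exact h

end Ergodicity

/-! ### Square-integrability yields a conull orbit -/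

section ConullOrbit

open Filter

variable {d : ℕ} {H : Subgroup (GL (Fin d) ℝ)}

/-- The Fourier-side formula is a parameter integral whose integrand is jointly measurable in `(x,
h, ξ)`. -/
theorem stronglyMeasurable_wavelet (ψ f : L2 d) :
    StronglyMeasurable (wavelet ψ f : AffGroup H → ℂ) := by
  have hψ : StronglyMeasurable (𝓕 ψ : L2 d) := Lp.stronglyMeasurable _
  have hf : StronglyMeasurable (𝓕 f : L2 d) := Lp.stronglyMeasurable _
  have h1 : wavelet ψ f = fun g : AffGroup H => ((|(mat g.2).det| ^ (1 / 2 : ℝ) : ℝ) : ℂ) *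
      ∫ ξ, Complex.exp (((2 * Real.pi * inner ℝ ξ g.1 : ℝ) : ℂ) * Complex.I) •
        ((𝓕 f : L2 d) ξ * starRingEnd ℂ ((𝓕 ψ : L2 d) (dualAct g.2 ξ))) := by
    ext g
    rw [wavelet_eq_fourierInv ψ f (EventuallyEq.refl _ _) (EventuallyEq.refl _ _) g,
      Real.fourierInv_eq']
    rfl
  rw [h1]
  have hdet : Measurable fun g : Euc d × H => |(mat g.2).det| :=
    (continuous_mat.comp continuous_snd).matrix_det.abs.measurable
  refine StronglyMeasurable.mul (α := Euc d × H) ?_ ?_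
  · exact (Complex.measurable_ofReal.comp (hdet.pow_const _)).stronglyMeasurable
  · refine StronglyMeasurable.integral_prod_right' (f := fun p : (Euc d × H) × Euc d =>
      Complex.exp (((2 * Real.pi * inner ℝ p.2 p.1.1 : ℝ) : ℂ) * Complex.I) •
        ((𝓕 f : L2 d) p.2 * starRingEnd ℂ ((𝓕 ψ : L2 d) (dualAct p.1.2 p.2)))) ?_
    have hact : Measurable fun p : (Euc d × H) × Euc d => dualAct p.1.2 p.2 :=
      ((continuous_dualAct.comp (continuous_snd.comp continuous_fst)).clm_apply
        continuous_snd).measurable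
    have hexp : Measurable fun p : (Euc d × H) × Euc d =>
        Complex.exp (((2 * Real.pi * inner ℝ p.2 p.1.1 : ℝ) : ℂ) * Complex.I) := by
      refine Continuous.measurable ?_
      fun_prop
    have hf' : Measurable fun p : (Euc d × H) × Euc d => (𝓕 f : L2 d) p.2 :=
      hf.measurable.comp measurable_snd
    have hψ' : Measurable fun p : (Euc d × H) × Euc d =>
        starRingEnd ℂ ((𝓕 ψ : L2 d) (dualAct p.1.2 p.2)) :=
      Complex.continuous_conj.measurable.comp (hψ.measurable.comp hact)
    exact (hexp.smul (hf'.mul hψ')).stronglyMeasurable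

theorem measurable_ofReal_inv_abs_det :
    Measurable fun p : Euc d × H => ENNReal.ofReal (|(mat p.2).det|⁻¹) :=
  ENNReal.measurable_ofReal.comp
    (continuous_mat.comp continuous_snd).matrix_det.abs.measurable.inv

theorem lintegral_affHaar (μH : Measure H) [SFinite μH] {F : AffGroup H → ℝ≥0∞}
    (hF : Measurable F) : ∫⁻ g, F g ∂(affHaar μH) =
      ∫⁻ h, ENNReal.ofReal (|(mat h).det|⁻¹) * (∫⁻ x, F (AffGroup.mk x h)) ∂μH := by
  set F' : Euc d × H → ℝ≥0∞ := fun p => F (AffGroup.mk p.1 p.2)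
  have hF' : Measurable F' := hF
  have h1 : ∫⁻ g, F g ∂(affHaar μH) = ∫⁻ p : Euc d × H,
      ENNReal.ofReal (|(mat p.2).det|⁻¹) * F' p ∂(volume.prod μH) :=
    lintegral_withDensity_eq_lintegral_mul _ measurable_ofReal_inv_abs_det hF'
  have h2 : Measurable fun p : Euc d × H => ENNReal.ofReal (|(mat p.2).det|⁻¹) * F' p :=
    measurable_ofReal_inv_abs_det.mul hF'
  rw [h1, lintegral_prod_symm' _ h2]
  refine lintegral_congr fun h => ?_
  have h3 : Measurable fun x : Euc d => F' (x, h) := hF'.comp measurable_prodMk_right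
  exact lintegral_const_mul (ENNReal.ofReal (|(mat h).det|⁻¹)) h3

/-- Square-integrability of `W_ψ ψ` on the Fourier side. -/
theorem lintegral_mul_orbitIntegral_lt_top (μH : Measure H) [SFinite μH] {ψ : L2 d}
    (hψ : MemLp (fun g : AffGroup H => wavelet ψ ψ g) 2 (affHaar μH)) :
    ∫⁻ ξ, ‖(𝓕 ψ : L2 d) ξ‖ₑ ^ 2 * orbitIntegral μH (fun η => ‖(𝓕 ψ : L2 d) η‖ₑ ^ 2) ξ < ⊤ := by
  set P : Euc d → ℂ := ⇑(𝓕 ψ : L2 d)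
  have hPm : Measurable P := (Lp.stronglyMeasurable _).measurable
  have hp : Measurable fun η => ‖P η‖ₑ ^ 2 := hPm.enorm.pow_const 2
  have h1 : ∫⁻ g, ‖(wavelet ψ ψ g : ℂ)‖ₑ ^ 2 ∂(affHaar μH) < ⊤ := by
    have := hψ.2
    rw [eLpNorm_lt_top_iff_lintegral_rpow_enorm_lt_top (by norm_num) (by norm_num)] at this
    simpa using this
  have hWm : Measurable (wavelet ψ ψ : AffGroup H → ℂ) := (stronglyMeasurable_wavelet ψ ψ).measurable
  rw [lintegral_affHaar μH (hWm.enorm.pow_const 2)] at h1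
  -- Plancherel in `x` for fixed `h`; the factor `|det h|` of `|W_ψ ψ|²` cancels the Haar density
  -- `|det h|⁻¹`.
  have h2 : ∀ h : H, ∫⁻ ξ, ‖P ξ‖ₑ ^ 2 * ‖P (dualAct h ξ)‖ₑ ^ 2 ≤
      ENNReal.ofReal (|(mat h).det|⁻¹) * ∫⁻ x, ‖(wavelet ψ ψ (AffGroup.mk x h) : ℂ)‖ₑ ^ 2 := by
    intro h
    set F : Euc d → ℂ := fun ξ => P ξ * starRingEnd ℂ (P (dualAct h ξ))
    have hP2 : MemLp P 2 volume := Lp.memLp _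
    have hP2' : MemLp (fun ξ => starRingEnd ℂ (P (dualAct h ξ))) 2 volume := by
      have h3 := memLp_weighted_comp (m := fun _ => 1) (r := 1)
        (dualAct h).continuous.measurable (map_dualAct_volume h) ENNReal.ofReal_ne_top
        measurable_const (fun _ => by simp) hP2
      simp only [one_mul] at h3
      exact h3.star
    have hF : Integrable F := hP2.integrable_mul hP2'
    have hdet := abs_det_pos h
    have h4 : ∀ x, ‖(wavelet ψ ψ (AffGroup.mk x h) : ℂ)‖ₑ ^ 2
        = ENNReal.ofReal |(mat h).det| * ‖𝓕⁻ F x‖ₑ ^ 2 := by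
      intro x
      rw [wavelet_eq_fourierInv ψ ψ (EventuallyEq.refl _ _) (EventuallyEq.refl _ _)]
      change ‖((|(mat h).det| ^ (1 / 2 : ℝ) : ℝ) : ℂ) * 𝓕⁻ F x‖ₑ ^ 2 = _
      rw [enorm_mul, mul_pow]
      congr 1
      rw [← ofReal_norm, Complex.norm_real, Real.norm_of_nonneg (by positivity),
        ← ENNReal.ofReal_pow (by positivity), ← Real.rpow_natCast, ← Real.rpow_mul hdet.le]
      norm_num
    simp_rw [h4]
    rw [lintegral_const_mul' _ _ ENNReal.ofReal_ne_top, ← mul_assoc,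
      ← ENNReal.ofReal_mul (by positivity), inv_mul_cancel₀ hdet.ne', ENNReal.ofReal_one, one_mul]
    refine le_trans (le_of_eq (lintegral_congr fun ξ => ?_)) (lintegral_sq_le_of_fourierInv hF)
    rw [enorm_mul, mul_pow]
    congr 2
    exact (enorm_eq_iff_norm_eq.2 (RCLike.norm_conj _)).symm
  have h5 : ∫⁻ h, (∫⁻ ξ, ‖P ξ‖ₑ ^ 2 * ‖P (dualAct h ξ)‖ₑ ^ 2) ∂μH < ⊤ :=
    (lintegral_mono h2).trans_lt h1
  rw [lintegral_lintegral_swap] at h5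
  · refine lt_of_eq_of_lt (lintegral_congr fun ξ => ?_) h5
    rw [orbitIntegral, lintegral_const_mul]
    exact hp.comp (continuous_dualAct.clm_apply continuous_const).measurable
  · exact ((hp.comp measurable_snd).mul (hp.comp measurable_dualAct_apply)).aemeasurable

/-- There is a nonnull set whose indicator function has finite orbit integrals. -/
theorem exists_orbitIntegral_indicator_ne_top (hirr : QuasiRegIrreducible H) (μH : Measure H)
    [μH.IsMulLeftInvariant] [SFinite μH] (hsq : QuasiRegSquareIntegrable H μH) :
    ∃ E : Set (Euc d), MeasurableSet E ∧ volume E ≠ 0 ∧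
      ∀ᵐ ξ, orbitIntegral μH (E.indicator 1) ξ ≠ ⊤ := by
  obtain ⟨ψ, hψ0, hψ⟩ := hsq
  have hfin := lintegral_mul_orbitIntegral_lt_top μH hψ
  set P : Euc d → ℂ := ⇑(𝓕 ψ : L2 d)
  have hPm : Measurable P := (Lp.stronglyMeasurable _).measurable
  set p : Euc d → ℝ≥0∞ := fun η => ‖P η‖ₑ ^ 2
  have hp : Measurable p := hPm.enorm.pow_const 2
  have hp0 : volume {ξ | p ξ ≠ 0} ≠ 0 := by
    intro h
    apply hψ0
    have h1 : (𝓕 ψ : L2 d) = 0 := by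
      rw [Lp.eq_zero_iff_ae_eq_zero]
      filter_upwards [measure_eq_zero_iff_ae_notMem.1 h] with ξ hξ
      simpa [p] using hξ
    rw [← norm_eq_zero, ← Lp.norm_fourier_eq, h1, norm_zero]
  obtain ⟨c, hc⟩ := hirr.exists_orbitIntegral_eq_const μH hp
  -- An infinite constant would force `p = 0` almost everywhere, that is `ψ = 0`.
  have hctop : c ≠ ⊤ := by
    rintro rfl
    have h1 : ∫⁻ ξ, p ξ * ⊤ < ⊤ := by
      refine lt_of_eq_of_lt (lintegral_congr_ae ?_) hfin
      filter_upwards [hc] with ξ hξ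
      rw [hξ]
    have h2 := ae_lt_top (hp.mul_const ⊤) h1.ne
    refine hp0 (measure_mono_null ?_ h2)
    intro ξ hξ
    simp only [Set.mem_compl_iff, Set.mem_ofPred_eq, not_lt, top_le_iff]
    exact ENNReal.mul_top hξ
  obtain ⟨n, hn⟩ : ∃ n : ℕ, volume {ξ | ((n : ℝ≥0∞) + 1)⁻¹ < p ξ} ≠ 0 := by
    by_contra! h
    refine hp0 (measure_mono_null ?_ (measure_iUnion_null h))
    intro ξ hξ
    obtain ⟨n, hn⟩ := ENNReal.exists_inv_nat_lt hξ
    refine Set.mem_iUnion.2 ⟨n, lt_of_le_of_lt ?_ hn⟩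
    exact ENNReal.inv_le_inv.2 le_self_add
  refine ⟨_, measurableSet_lt measurable_const hp, hn, ?_⟩
  filter_upwards [hc] with ξ hξ
  -- Markov's inequality along the orbit; `n + 1` instead of `n` keeps the factor invertible.
  have h1 : orbitIntegral μH ({ξ | ((n : ℝ≥0∞) + 1)⁻¹ < p ξ}.indicator 1) ξ
      ≤ ((n : ℝ≥0∞) + 1) * orbitIntegral μH p ξ := by
    have hn1 : ((n : ℝ≥0∞) + 1) ≠ ⊤ := by finiteness
    rw [orbitIntegral, orbitIntegral, ← lintegral_const_mul' _ _ hn1]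
    refine lintegral_mono fun h => ?_
    rw [Set.indicator_apply]
    split_ifs with h2
    · have h3 := mul_le_mul_right (le_of_lt h2) ((n : ℝ≥0∞) + 1)
      rwa [ENNReal.mul_inv_cancel (by positivity) hn1] at h3
    · exact zero_le
  rw [hξ] at h1
  exact ne_top_of_le_ne_top (ENNReal.mul_ne_top (by finiteness) hctop) h1

/-- Finite intersections of a generating sequence. Countability lets the a.e. statements for all
sets of the system hold at one point simultaneously. -/
theorem exists_countable_isPiSystem (α : Type*) [m : MeasurableSpace α]
    [MeasurableSpace.CountablyGenerated α] : ∃ S : Set (Set α), S.Countable ∧ IsPiSystem S ∧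
      m = MeasurableSpace.generateFrom S ∧ ∀ s ∈ S, MeasurableSet s := by
  set t := MeasurableSpace.natGeneratingSequence α
  have hm : ∀ s ∈ Set.range fun F : Finset ℕ => ⋂ n ∈ F, t n, MeasurableSet s := by
    rintro _ ⟨F, rfl⟩
    exact F.measurableSet_biInter fun n _ => MeasurableSpace.measurableSet_natGeneratingSequence n
  refine ⟨Set.range fun F : Finset ℕ => ⋂ n ∈ F, t n, Set.countable_range _, ?_, ?_, hm⟩
  · rintro _ ⟨F, rfl⟩ _ ⟨G, rfl⟩ _
    refine ⟨F ∪ G, ?_⟩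
    ext x
    simp only [Set.mem_iInter, Finset.mem_union, Set.mem_inter_iff]
    exact ⟨fun h => ⟨fun n hn => h n (Or.inl hn), fun n hn => h n (Or.inr hn)⟩,
      fun h n hn => hn.elim (h.1 n) (h.2 n)⟩
  · refine le_antisymm ?_ (MeasurableSpace.generateFrom_le hm)
    conv_lhs => rw [← MeasurableSpace.generateFrom_natGeneratingSequence α]
    refine MeasurableSpace.generateFrom_mono ?_
    rintro _ ⟨n, rfl⟩
    exact ⟨{n}, by simp [t]⟩

theorem lintegral_orbitIntegral (μH : Measure H) [SFinite μH] {b : Euc d → ℝ≥0∞}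
    (hb : Measurable b) : ∫⁻ ξ, orbitIntegral μH b ξ =
      ∫⁻ h, ENNReal.ofReal |(mat h).det⁻¹| * (∫⁻ ξ, b ξ) ∂μH := by
  simp only [orbitIntegral]
  rw [lintegral_lintegral_swap]
  · exact lintegral_congr fun h => lintegral_comp_dualAct h hb
  · exact (hb.comp (measurable_dualAct_apply.comp measurable_swap)).aemeasurable

/-- An irreducible square-integrable quasi-regular representation has a conull dual orbit, over
which some nonnull set has finite positive orbit integral. -/
theorem exists_conull_dualOrbit (hH : IsClosed (H : Set (GL (Fin d) ℝ))) (μH : Measure H)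
    [μH.IsHaarMeasure] (hirr : QuasiRegIrreducible H) (hsq : QuasiRegSquareIntegrable H μH) :
    ∃ ξ₁ : Euc d, (∀ᵐ ξ, ξ ∈ dualOrbit H ξ₁) ∧ ∃ E : Set (Euc d), MeasurableSet E ∧
      orbitIntegral μH (E.indicator 1) ξ₁ ≠ 0 ∧ orbitIntegral μH (E.indicator 1) ξ₁ ≠ ⊤ := by
  have := sigmaCompactSpace_of_isClosed hH
  obtain ⟨E, hE, hE0, hEtop⟩ := exists_orbitIntegral_indicator_ne_top hirr μH hsq
  have hone : Measurable (1 : Euc d → ℝ≥0∞) := measurable_one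
  have hpos : ∀ᵐ ξ, orbitIntegral μH (E.indicator 1) ξ ≠ 0 := by
    obtain ⟨c, hc⟩ := hirr.exists_orbitIntegral_eq_const μH (hone.indicator hE)
    -- Otherwise Tonelli would make `∫_H |det h|⁻¹ vol(E) dh` vanish, although its integrand is
    -- positive.
    have hc0 : c ≠ 0 := by
      rintro rfl
      have h1 := lintegral_orbitIntegral μH (hone.indicator hE)
      rw [lintegral_congr_ae hc, lintegral_zero, lintegral_indicator_one hE, eq_comm,
        lintegral_eq_zero_iff] at h1
      · obtain ⟨h, hh⟩ := h1.exists
        simp only [Pi.zero_apply, mul_eq_zero, hE0, or_false, ENNReal.ofReal_eq_zero] at hh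
        exact absurd hh (not_le.2 (abs_pos.2 (inv_ne_zero (mat_det_ne_zero h))))
      · exact (ENNReal.measurable_ofReal.comp
          continuous_mat.matrix_det.measurable.inv.abs).mul_const _
    filter_upwards [hc] with ξ hξ
    rwa [hξ]
  obtain ⟨S, hSc, hSpi, hSgen, hSm⟩ := exists_countable_isPiSystem (Euc d)
  have hconst : ∀ B ∈ S, ∃ c : ℝ≥0∞, ∀ᵐ ξ, orbitIntegral μH ((E ∩ B).indicator 1) ξ = c :=
    fun B hB => hirr.exists_orbitIntegral_eq_const μH (hone.indicator (hE.inter (hSm B hB)))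
  choose! c hc using hconst
  obtain ⟨cE, hcE⟩ := hirr.exists_orbitIntegral_eq_const μH (hone.indicator hE)
  have hall : ∀ᵐ ξ, ∀ B ∈ S, orbitIntegral μH ((E ∩ B).indicator 1) ξ = c B :=
    (ae_ball_iff hSc).2 hc
  obtain ⟨ξ₁, hξ₁, hξ₁E, hξ₁0, hξ₁top⟩ := (hall.and (hcE.and (hpos.and hEtop))).exists
  refine ⟨ξ₁, ?_, E, hE, hξ₁0, hξ₁top⟩
  -- `ν ξ` is carried by the orbit of `ξ`. It is finite at `ξ₁`, and a.e. equal to `ν ξ₁` because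
  -- both agree on the π-system and in total mass.
  set ν : Euc d → Measure (Euc d) := fun ξ => (Measure.map (fun h => dualAct h ξ) μH).restrict E
  have hact : ∀ ξ : Euc d, Measurable fun h : H => dualAct h ξ := fun ξ =>
    (continuous_dualAct.clm_apply continuous_const).measurable
  have hν : ∀ ξ B, MeasurableSet B → ν ξ B = orbitIntegral μH ((E ∩ B).indicator 1) ξ := by
    intro ξ B hB
    rw [Measure.restrict_apply hB, Set.inter_comm, ← lintegral_indicator_one (hE.inter hB),
      lintegral_map (hone.indicator (hE.inter hB)) (hact ξ)]
    rfl
  have hνuniv : ∀ ξ, ν ξ Set.univ = orbitIntegral μH (E.indicator 1) ξ := fun ξ => by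
    rw [hν ξ _ MeasurableSet.univ, Set.inter_univ]
  filter_upwards [hall, hcE, hpos] with ξ hξ hξE hξ0
  have : IsFiniteMeasure (ν ξ₁) := ⟨by rw [hνuniv]; exact lt_top_iff_ne_top.2 hξ₁top⟩
  have heq : ν ξ₁ = ν ξ := by
    refine ext_of_generate_finite S hSgen hSpi (fun B hB => ?_) ?_
    · rw [hν _ _ (hSm B hB), hν _ _ (hSm B hB), hξ B hB, hξ₁ B hB]
    · rw [hνuniv, hνuniv, hξE, hξ₁E]
  have hO := measurableSet_dualOrbit hH ξ₁
  have h1 : ν ξ₁ (dualOrbit H ξ₁)ᶜ = 0 := by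
    rw [hν _ _ hO.compl, orbitIntegral]
    refine (lintegral_congr fun h => ?_).trans lintegral_zero
    rw [Set.indicator_of_notMem]
    exact fun h' => h'.2 ⟨h, rfl⟩
  -- If `ξ` is off the orbit of `ξ₁`, then `ν ξ` gives that orbit no mass and `ν ξ₁` gives its
  -- complement none, so the common measure is zero.
  by_contra hcon
  apply hξ0
  rw [← hνuniv, ← heq, ← Set.compl_union_self (dualOrbit H ξ₁)]
  refine le_antisymm ((measure_union_le _ _).trans ?_) (zero_le)
  rw [h1, zero_add, heq, hν _ _ hO, orbitIntegral]
  refine le_of_eq ((lintegral_congr fun h => ?_).trans lintegral_zero)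
  rw [Set.indicator_of_notMem]
  rintro ⟨-, g, hg⟩
  apply hcon
  refine ⟨g * h⁻¹, ?_⟩
  change dualAct (g * h⁻¹) ξ₁ = ξ
  have hg' : dualAct g ξ₁ = dualAct h ξ := hg
  rw [dualAct_mul, hg', dualAct_inv_dualAct]

end ConullOrbit

/-! ### Properness of the dual action over the open orbit -/

section Properness

open Filter Topology Pointwise

variable {d : ℕ} {H : Subgroup (GL (Fin d) ℝ)}

theorem dualOrbit_eq_of_mem {ξ η : Euc d} (h : η ∈ dualOrbit H ξ) :
    dualOrbit H η = dualOrbit H ξ := by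
  obtain ⟨g, rfl⟩ := h
  change Set.range (fun h => dualAct h (dualAct g ξ)) = Set.range fun h => dualAct h ξ
  simp_rw [← dualAct_mul]
  exact (mul_left_surjective g).range_comp (fun h => dualAct h ξ)

theorem mem_dualOrbit_self (ξ : Euc d) : ξ ∈ dualOrbit H ξ := ⟨1, dualAct_one ξ⟩

/-- The stabilizers over a point with a finite positive orbit integral are relatively compact. -/
theorem exists_isCompact_stabilizer_subset (hH : IsClosed (H : Set (GL (Fin d) ℝ)))
    (μH : Measure H) [μH.IsMulLeftInvariant] {ξ₀ : Euc d} {E : Set (Euc d)}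
    (hE : MeasurableSet E) (h0 : orbitIntegral μH (E.indicator 1) ξ₀ ≠ 0)
    (htop : orbitIntegral μH (E.indicator 1) ξ₀ ≠ ⊤) :
    ∃ C : Set H, IsCompact C ∧ ∀ h : H, dualAct h ξ₀ = ξ₀ → h ∈ C := by
  have := sigmaCompactSpace_of_isClosed hH
  -- `A` has finite positive measure and is stable under left multiplication by the stabilizer.
  set A : Set H := {h | dualAct h ξ₀ ∈ E}
  have hA : MeasurableSet A :=
    (continuous_dualAct.clm_apply continuous_const).measurable hE
  have hμA : orbitIntegral μH (E.indicator 1) ξ₀ = μH A := by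
    rw [← lintegral_indicator_one hA]; rfl
  rw [hμA] at h0 htop
  obtain ⟨n, hn⟩ : ∃ n, μH (A ∩ compactCovering H n) ≠ 0 := by
    by_contra! h
    refine h0 (measure_mono_null ?_ (measure_iUnion_null h))
    rw [← Set.inter_iUnion, iUnion_compactCovering, Set.inter_univ]
  set L := compactCovering H n
  have hL : IsCompact L := isCompact_compactCovering H n
  have hLL : IsCompact (L * L⁻¹) := hL.mul hL.inv
  by_contra! hcon
  -- Pick stabilizer elements `k n` outside all earlier `k m L L⁻¹`. Then the sets `k n (A ∩ L)` are
  -- disjoint, of equal positive measure and inside `A`, which has finite measure.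
  obtain ⟨k, hkS, hk⟩ := exists_seq_of_forall_finset_exists (fun h : H => dualAct h ξ₀ = ξ₀)
    (fun a b => b ∉ a • (L * L⁻¹)) (fun s _ => by
      obtain ⟨h, hh, hhC⟩ := hcon (⋃ a ∈ s, a • (L * L⁻¹))
        (s.isCompact_biUnion fun a _ => hLL.smul a)
      refine ⟨h, hh, fun a ha hmem => hhC ?_⟩
      exact Set.mem_biUnion ha hmem)
  have hdisj : Pairwise (Function.onFun Disjoint fun n => k n • (A ∩ L)) := by
    have key : ∀ m n, m < n → Disjoint (k m • (A ∩ L)) (k n • (A ∩ L)) := by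
      intro m n hmn
      rw [Set.disjoint_left]
      rintro _ ⟨a, ha, rfl⟩ ⟨b, hb, hab⟩
      apply hk m n hmn
      refine ⟨a * b⁻¹, Set.mul_mem_mul ha.2 (Set.inv_mem_inv.2 hb.2), ?_⟩
      simp only [smul_eq_mul] at hab ⊢
      rw [← mul_assoc, ← hab, mul_inv_cancel_right]
    intro m n hmn
    rcases lt_or_gt_of_ne hmn with h | h
    · exact key m n h
    · exact (key n m h).symm
  have hsub : (⋃ n, k n • (A ∩ L)) ⊆ A := by
    refine Set.iUnion_subset fun n => ?_
    rintro _ ⟨a, ha, rfl⟩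
    change dualAct (k n * a) ξ₀ ∈ E
    rw [dualAct_mul, hkS]
    exact ha.1
  have hmeas : ∀ n, MeasurableSet (k n • (A ∩ L)) := fun n =>
    (hA.inter hL.measurableSet).const_smul (k n)
  have hle := measure_mono (μ := μH) hsub
  rw [measure_iUnion hdisj hmeas] at hle
  simp_rw [measure_smul] at hle
  rw [ENNReal.tsum_const_eq_top_of_ne_zero hn] at hle
  exact htop (top_le_iff.1 hle)

/-- Compact subsets of an open dual orbit lift to compact subsets of the group. -/
theorem exists_isCompact_subset_image (hH : IsClosed (H : Set (GL (Fin d) ℝ))) {ξ₀ : Euc d}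
    (hO : IsOpen (dualOrbit H ξ₀)) {K : Set (Euc d)} (hK : IsCompact K)
    (hKO : K ⊆ dualOrbit H ξ₀) :
    ∃ L : Set H, IsCompact L ∧ K ⊆ (fun h => dualAct h ξ₀) '' L := by
  have := sigmaCompactSpace_of_isClosed hH
  have := locallyCompactSpace_of_isClosed hH
  have hmem : ∀ (h : H) (ξ : dualOrbit H ξ₀), dualAct h (ξ : Euc d) ∈ dualOrbit H ξ₀ := by
    rintro h ⟨_, g, rfl⟩
    exact ⟨g * h, dualAct_mul g h ξ₀⟩
  -- Acting by `h⁻¹` turns the right action into a left one.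
  let act : MulAction H (dualOrbit H ξ₀) :=
    { smul := fun h ξ => ⟨dualAct h⁻¹ (ξ : Euc d), hmem _ ξ⟩
      one_smul := fun ξ => Subtype.ext (by
        change dualAct (1 : H)⁻¹ (ξ : Euc d) = ξ
        rw [inv_one, dualAct_one])
      mul_smul := fun g h ξ => Subtype.ext (by
        change dualAct (g * h)⁻¹ (ξ : Euc d) = dualAct g⁻¹ (dualAct h⁻¹ (ξ : Euc d))
        rw [mul_inv_rev, dualAct_mul]) }
  have : ContinuousSMul H (dualOrbit H ξ₀) := ⟨by
    refine Continuous.subtype_mk ?_ _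
    exact (continuous_dualAct.comp (continuous_inv.comp continuous_fst)).clm_apply
      (continuous_subtype_val.comp continuous_snd)⟩
  have : MulAction.IsPretransitive H (dualOrbit H ξ₀) := ⟨by
    rintro ⟨_, g, rfl⟩ ⟨_, h, rfl⟩
    refine ⟨(g⁻¹ * h)⁻¹, Subtype.ext ?_⟩
    change dualAct (g⁻¹ * h)⁻¹⁻¹ (dualAct g ξ₀) = dualAct h ξ₀
    rw [inv_inv, ← dualAct_mul, mul_inv_cancel_left]⟩
  have : LocallyCompactSpace (dualOrbit H ξ₀) := hO.locallyCompactSpace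
  -- Baire category: a σ-compact group acting transitively and continuously on a locally compact
  -- Hausdorff space has open orbit maps.
  have hopen := isOpenMap_smul_of_sigmaCompact (G := H)
    (⟨ξ₀, mem_dualOrbit_self ξ₀⟩ : dualOrbit H ξ₀)
  have hopen' : ∀ U : Set H, IsOpen U → IsOpen ((fun h => dualAct h ξ₀) '' U) := by
    intro U hU
    have h1 := hO.isOpenMap_subtype_val _ (hopen _ hU.inv)
    convert h1 using 1
    ext η
    constructor
    · rintro ⟨h, hh, rfl⟩
      refine ⟨_, ⟨h⁻¹, Set.inv_mem_inv.2 hh, rfl⟩, ?_⟩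
      change dualAct h⁻¹⁻¹ ξ₀ = dualAct h ξ₀
      rw [inv_inv]
    · rintro ⟨_, ⟨h, hh, rfl⟩, rfl⟩
      exact ⟨h⁻¹, hh, rfl⟩
  let ex : CompactExhaustion H := default
  obtain ⟨n, hn⟩ := hK.elim_directed_cover (fun n => (fun h => dualAct h ξ₀) '' interior (ex n))
    (fun n => hopen' _ isOpen_interior) (by
      intro ξ hξ
      obtain ⟨h, rfl⟩ := hKO hξ
      obtain ⟨n, hn⟩ := ex.exists_mem_nhds h
      exact Set.mem_iUnion.2 ⟨n, h, mem_interior_iff_mem_nhds.2 hn, rfl⟩)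
    (Monotone.directed_le fun m n hmn => Set.image_mono (interior_mono (ex.subset hmn)))
  exact ⟨ex n, ex.isCompact n, hn.trans (Set.image_mono interior_subset)⟩

/-- The dual action is proper over an open orbit with finite positive orbit integrals. -/
theorem exists_isCompact_return (hH : IsClosed (H : Set (GL (Fin d) ℝ)))
    (μH : Measure H) [μH.IsMulLeftInvariant] {ξ₀ : Euc d} {E : Set (Euc d)}
    (hE : MeasurableSet E) (h0 : orbitIntegral μH (E.indicator 1) ξ₀ ≠ 0)
    (htop : orbitIntegral μH (E.indicator 1) ξ₀ ≠ ⊤)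
    (hO : IsOpen (dualOrbit H ξ₀)) {K : Set (Euc d)} (hK : IsCompact K)
    (hKO : K ⊆ dualOrbit H ξ₀) :
    ∃ C : Set H, IsCompact C ∧ ∀ h : H, ∀ ξ ∈ K, dualAct h ξ ∈ K → h ∈ C := by
  obtain ⟨S, hS, hstab⟩ := exists_isCompact_stabilizer_subset hH μH hE h0 htop
  obtain ⟨L, hL, hKL⟩ := exists_isCompact_subset_image hH hO hK hKO
  have hD : ∀ h : H, dualAct h ξ₀ ∈ K → h ∈ S * L := by
    intro h hh
    obtain ⟨l, hl, hlh⟩ := hKL hh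
    refine ⟨h * l⁻¹, hstab _ ?_, l, hl, by simp⟩
    have hlh' : dualAct l ξ₀ = dualAct h ξ₀ := hlh
    rw [dualAct_mul, ← hlh', dualAct_inv_dualAct]
  -- With `ξ = aᵀ ξ₀`, both `a` and `a h` carry `ξ₀` into `K`, hence lie in `S L`, and `h = a⁻¹ (a
  -- h)`.
  refine ⟨(S * L)⁻¹ * (S * L), (hS.mul hL).inv.mul (hS.mul hL), fun h ξ hξ hhξ => ?_⟩
  obtain ⟨a, rfl⟩ := hKO hξ
  change dualAct h (dualAct a ξ₀) ∈ K at hhξ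
  rw [← dualAct_mul] at hhξ
  exact ⟨a⁻¹, Set.inv_mem_inv.2 (hD a hξ), a * h, hD _ hhξ, by simp⟩

end Properness

/-! ### Uniform rapid decay of Fourier transforms -/

section Decay

variable {d : ℕ}

/-- By Leibniz and the chain rule, `A` enters only through powers of `‖A‖`; the derivatives of `f`
supply integrability and those of `g` are bounded. -/
theorem integral_norm_iteratedFDeriv_mul_comp_le {f g : Euc d → ℂ} (hf : ContDiff ℝ ∞ f)
    (hfc : HasCompactSupport f) (hg : ContDiff ℝ ∞ g) (hgc : HasCompactSupport g) {R : ℝ}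
    (n : ℕ) : ∃ M : ℝ, ∀ A : Euc d →L[ℝ] Euc d, ‖A‖ ≤ R →
      ∫ ξ, ‖iteratedFDeriv ℝ n (fun ξ => f ξ * g (A ξ)) ξ‖ ≤ M := by
  have hbd : ∀ j : ℕ, ∃ B : ℝ, ∀ ξ, ‖iteratedFDeriv ℝ j g ξ‖ ≤ B := fun j =>
    (hgc.iteratedFDeriv j).exists_bound_of_continuous
      (hg.continuous_iteratedFDeriv (by exact_mod_cast le_top))
  choose B hB using hbd
  have hint : ∀ i : ℕ, Integrable (fun ξ => ‖iteratedFDeriv ℝ i f ξ‖) := fun i =>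
    ((hf.continuous_iteratedFDeriv (by exact_mod_cast le_top)).integrable_of_hasCompactSupport
      (hfc.iteratedFDeriv i)).norm
  refine ⟨∫ ξ, ∑ i ∈ Finset.range (n + 1), (n.choose i : ℝ) * ‖iteratedFDeriv ℝ i f ξ‖ *
    (B (n - i) * R ^ (n - i)), fun A hA => ?_⟩
  refine integral_mono_of_nonneg (Filter.Eventually.of_forall fun ξ => norm_nonneg _) ?_
    (Filter.Eventually.of_forall fun ξ => ?_)
  · exact integrable_finsetSum _ fun i _ => ((hint i).const_mul _).mul_const _
  have hgA : ContDiff ℝ ∞ fun ξ => g (A ξ) := hg.comp A.contDiff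
  refine (norm_iteratedFDeriv_mul_le (N := ∞) hf hgA ξ (by exact_mod_cast le_top)).trans ?_
  refine Finset.sum_le_sum fun i _ => mul_le_mul_of_nonneg_left ?_ (by positivity)
  have hle : ((n - i : ℕ) : WithTop ℕ∞) ≤ ((⊤ : ℕ∞) : WithTop ℕ∞) := by
    exact WithTop.coe_le_coe.2 (le_top : ((n - i : ℕ) : ℕ∞) ≤ ⊤)
  have h1 := A.iteratedFDeriv_comp_right hg ξ hle
  change ‖iteratedFDeriv ℝ (n - i) (g ∘ A) ξ‖ ≤ _
  rw [h1]
  refine (ContinuousMultilinearMap.norm_compContinuousLinearMap_le _ _).trans ?_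
  simp only [Finset.prod_const, Finset.card_univ, Fintype.card_fin]
  exact mul_le_mul (hB _ _) (pow_le_pow_left₀ (norm_nonneg _) hA _) (by positivity)
    ((norm_nonneg _).trans (hB _ 0))

/-- The Fourier transforms of `f · (g ∘ A)` decay rapidly, uniformly for bounded `A`. -/
theorem norm_fourierInv_mul_comp_le {f g : Euc d → ℂ} (hf : ContDiff ℝ ∞ f)
    (hfc : HasCompactSupport f) (hg : ContDiff ℝ ∞ g) (hgc : HasCompactSupport g) (R : ℝ)
    (n : ℕ) : ∃ M : ℝ, ∀ A : Euc d →L[ℝ] Euc d, ‖A‖ ≤ R → ∀ x : Euc d,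
      (1 + ‖x‖) ^ n * ‖𝓕⁻ (fun ξ => f ξ * g (A ξ)) x‖ ≤ M := by
  have hpow : ∀ n : ℕ, ∃ M : ℝ, ∀ A : Euc d →L[ℝ] Euc d, ‖A‖ ≤ R → ∀ x : Euc d,
      ‖x‖ ^ n * ‖𝓕⁻ (fun ξ => f ξ * g (A ξ)) x‖ ≤ M := by
    intro n
    choose M hM using fun j => integral_norm_iteratedFDeriv_mul_comp_le (R := R) hf hfc hg hgc j
    refine ⟨2 ^ n * ∑ j ∈ Finset.range (n + 1), M j, fun A hA x => ?_⟩
    have hF : ContDiff ℝ ∞ fun ξ => f ξ * g (A ξ) := hf.mul (hg.comp A.contDiff)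
    have hFc : HasCompactSupport fun ξ => f ξ * g (A ξ) := hfc.mul_right
    have h1 := Real.pow_mul_norm_iteratedFDeriv_fourier_le (K := ⊤) (N := ⊤)
      (f := fun ξ => f ξ * g (A ξ)) hF (fun k n _ _ => by
        refine Continuous.integrable_of_hasCompactSupport ?_ (hFc.iteratedFDeriv n).norm.mul_left
        exact (continuous_norm.pow k).mul
          (hF.continuous_iteratedFDeriv (by exact_mod_cast le_top)).norm)
      -- No derivative of the transform is needed, and `-x` converts `𝓕` into `𝓕⁻`.
      (k := 0) (n := n) le_top le_top (-x)
    rw [norm_iteratedFDeriv_zero, norm_neg, ← Real.fourierInv_eq_fourier_neg] at h1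
    refine h1.trans ?_
    rw [Finset.sum_product]
    simp only [zero_add, Finset.range_one, Finset.sum_singleton, pow_zero, one_mul,
      CharP.cast_eq_zero, mul_zero]
    exact mul_le_mul_of_nonneg_left (Finset.sum_le_sum fun j _ => hM j A hA) (by positivity)
  obtain ⟨M₀, hM₀⟩ := hpow 0
  obtain ⟨M₁, hM₁⟩ := hpow n
  refine ⟨2 ^ (n - 1) * (M₀ + M₁), fun A hA x => ?_⟩
  have h1 := add_pow_le zero_le_one (norm_nonneg x) n
  rw [one_pow] at h1
  refine (mul_le_mul_of_nonneg_right h1 (norm_nonneg _)).trans ?_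
  rw [mul_assoc, add_mul]
  refine mul_le_mul_of_nonneg_left (add_le_add ?_ (hM₁ A hA x)) (by positivity)
  simpa using hM₀ A hA x

end Decay

/-! ### Weighted integrability of wavelet coefficients -/

section Integrability

open Filter Topology

variable {d : ℕ} {H : Subgroup (GL (Fin d) ℝ)}

theorem IsWeight.measurable {v : AffGroup H → ℝ} (hv : IsWeight v) : Measurable v := by
  have h : Continuous (fun p : Euc d × H => v (AffGroup.mk p.1 p.2)) := hv.continuous
  exact h.measurable

/-- Vectors whose Fourier transform is smooth with compact support in a properly acted-on open
set are `v`-integrable. -/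
theorem memL1v_of_fourierInCcInfty (hH : IsClosed (H : Set (GL (Fin d) ℝ)))
    (μH : Measure H) [μH.IsHaarMeasure] {v : AffGroup H → ℝ} (hv : IsWeight v)
    {w : H → ℝ} (hw : IsWeight w) {s : ℝ}
    (hvw : ∀ (x : Euc d) (h : H), v (AffGroup.mk x h) ≤ (1 + ‖x‖) ^ s * w h)
    {O : Set (Euc d)} (hproper : ∀ K : Set (Euc d), IsCompact K → K ⊆ O →
      ∃ C : Set H, IsCompact C ∧ ∀ h : H, ∀ ξ ∈ K, dualAct h ξ ∈ K → h ∈ C)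
    {ψ : L2 d} (hψ : FourierInCcInfty O ψ) : MemL1v μH v (wavelet ψ ψ) := by
  have := sigmaCompactSpace_of_isClosed hH
  obtain ⟨f, hf, hfc, hfO, hψf⟩ := hψ
  obtain ⟨C, hC, hCret⟩ := hproper _ hfc hfO
  set g : Euc d → ℂ := fun ξ => starRingEnd ℂ (f ξ)
  have hg : ContDiff ℝ ∞ g := Complex.conjCLE.contDiff.comp hf
  have hgc : HasCompactSupport g := hfc.comp_left (map_zero _)
  have hW : ∀ (x : Euc d) (h : H), wavelet ψ ψ (AffGroup.mk x h) =
      ((|(mat h).det| ^ (1 / 2 : ℝ) : ℝ) : ℂ) * 𝓕⁻ (fun ξ => f ξ * g (dualAct h ξ)) x :=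
    fun x h => wavelet_eq_fourierInv ψ ψ hψf hψf (AffGroup.mk x h)
  -- If `f · (g ∘ hᵀ)` is nonzero at `ξ`, both `ξ` and `hᵀ ξ` lie in the support of `f`, so `h` is
  -- in `C`.
  have hW0 : ∀ (x : Euc d) (h : H), h ∉ C → wavelet ψ ψ (AffGroup.mk x h) = 0 := by
    intro x h hh
    have h1 : (fun ξ => f ξ * g (dualAct h ξ)) = fun _ => 0 := by
      ext ξ
      by_contra hne
      have h2 := left_ne_zero_of_mul hne
      have h3 : f (dualAct h ξ) ≠ 0 := fun h4 => right_ne_zero_of_mul hne (by simp [g, h4])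
      exact hh (hCret h ξ (subset_tsupport _ h2) (subset_tsupport _ h3))
    rw [hW, h1, Real.fourierInv_eq']
    simp
  have hdet : Continuous fun h : H => |(mat h).det| := continuous_mat.matrix_det.abs
  obtain ⟨R, hR⟩ := hC.exists_bound_of_continuousOn continuous_dualAct.continuousOn
  obtain ⟨D, hD⟩ := hC.exists_bound_of_continuousOn (f := fun h : H =>
    |(mat h).det| ^ (1 / 2 : ℝ)) (hdet.rpow_const fun h => Or.inr (by norm_num)).continuousOn
  obtain ⟨D', hD'⟩ := hC.exists_bound_of_continuousOn (f := fun h : H => |(mat h).det|⁻¹)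
    (hdet.inv₀ fun h => (abs_det_pos h).ne').continuousOn
  obtain ⟨B, hB⟩ := hC.exists_bound_of_continuousOn hw.continuous.continuousOn
  -- Decay of order `N` absorbs the growth `(1 + ‖x‖)^s` and leaves the integrable `(1 + ‖x‖)^{-(d +
  -- 1)}`.
  obtain ⟨N, hN⟩ := exists_nat_ge (s + (d + 1))
  obtain ⟨M, hM⟩ := norm_fourierInv_mul_comp_le hf hfc hg hgc R N
  have hmeas := stronglyMeasurable_wavelet (H := H) ψ ψ
  have hprod : Measurable fun g : AffGroup H => ‖wavelet ψ ψ g‖ * v g :=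
    hmeas.measurable.norm.mul hv.measurable
  refine ⟨hmeas.aestronglyMeasurable, hprod.aestronglyMeasurable, ?_⟩
  rw [hasFiniteIntegral_iff_enorm, lintegral_affHaar μH hprod.enorm]
  have hpt : ∀ h ∈ C, ∀ x : Euc d, ‖wavelet ψ ψ (AffGroup.mk x h)‖ * v (AffGroup.mk x h)
      ≤ (D * M * B) * (1 + ‖x‖) ^ (-(d + 1 : ℝ)) := by
    intro h hh x
    have hx : 0 < 1 + ‖x‖ := by positivity
    have hx1 : 1 ≤ 1 + ‖x‖ := by linarith [norm_nonneg x]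
    have h1 : |(mat h).det| ^ (1 / 2 : ℝ) ≤ D := (le_abs_self _).trans (hD h hh)
    have h2 : w h ≤ B := (le_abs_self _).trans (hB h hh)
    have h3 := hM (dualAct h) (hR h hh) x
    have h4 : v (AffGroup.mk x h) ≤ (1 + ‖x‖) ^ s * B :=
      (hvw x h).trans (mul_le_mul_of_nonneg_left h2 (by positivity))
    have hD0 : 0 ≤ D := le_trans (by positivity) h1
    have hB0 : 0 ≤ B := (hw.pos h).le.trans h2
    have hM0 : 0 ≤ M := le_trans (by positivity) h3
    rw [hW, norm_mul, Complex.norm_real, Real.norm_of_nonneg (by positivity)]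
    set T := ‖𝓕⁻ (fun ξ => f ξ * g (dualAct h ξ)) x‖
    have h5 : (1 + ‖x‖) ^ s ≤ (1 + ‖x‖) ^ N * (1 + ‖x‖) ^ (-(d + 1 : ℝ)) := by
      rw [← Real.rpow_natCast, ← Real.rpow_add hx]
      exact Real.rpow_le_rpow_of_exponent_le hx1 (by linarith)
    calc |(mat h).det| ^ (1 / 2 : ℝ) * T * v (AffGroup.mk x h)
        ≤ D * T * ((1 + ‖x‖) ^ s * B) :=
          mul_le_mul (mul_le_mul_of_nonneg_right h1 (norm_nonneg _)) h4 (hv.pos _).le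
            (mul_nonneg hD0 (norm_nonneg _))
      _ ≤ D * T * (((1 + ‖x‖) ^ N * (1 + ‖x‖) ^ (-(d + 1 : ℝ))) * B) := by
          gcongr
      _ = D * ((1 + ‖x‖) ^ N * T) * B * (1 + ‖x‖) ^ (-(d + 1 : ℝ)) := by ring
      _ ≤ (D * M * B) * (1 + ‖x‖) ^ (-(d + 1 : ℝ)) := by
          gcongr
  set J : ℝ≥0∞ := ∫⁻ x : Euc d, ENNReal.ofReal ((1 + ‖x‖) ^ (-(d + 1 : ℝ)))
  have hJ : J < ⊤ := finite_integral_one_add_norm (by simp)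
  have hinner : ∀ h : H, ENNReal.ofReal (|(mat h).det|⁻¹) *
      (∫⁻ x, ‖‖wavelet ψ ψ (AffGroup.mk x h)‖ * v (AffGroup.mk x h)‖ₑ) ≤
      C.indicator (fun _ => ENNReal.ofReal D' * (ENNReal.ofReal (D * M * B) * J)) h := by
    intro h
    by_cases hh : h ∈ C
    · rw [Set.indicator_of_mem hh]
      gcongr
      · exact (le_abs_self _).trans (hD' h hh)
      · rw [← lintegral_const_mul' _ _ ENNReal.ofReal_ne_top]
        refine lintegral_mono fun x => ?_
        have h0 : 0 ≤ ‖wavelet ψ ψ (AffGroup.mk x h)‖ * v (AffGroup.mk x h) :=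
          mul_nonneg (norm_nonneg _) (hv.pos _).le
        rw [Real.enorm_of_nonneg h0, ← ENNReal.ofReal_mul' (by positivity)]
        exact ENNReal.ofReal_le_ofReal (hpt h hh x)
    · rw [Set.indicator_of_notMem hh]
      simp [hW0 _ h hh]
  refine (lintegral_mono hinner).trans_lt ?_
  rw [lintegral_indicator_const hC.measurableSet]
  exact ENNReal.mul_lt_top (ENNReal.mul_lt_top ENNReal.ofReal_lt_top
    (ENNReal.mul_lt_top ENNReal.ofReal_lt_top hJ)) hC.measure_lt_top

theorem exists_fourier_ae_eq {f : Euc d → ℂ} (hf : ContDiff ℝ ∞ f) (hfc : HasCompactSupport f) :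
    ∃ ψ : L2 d, (𝓕 ψ : L2 d) =ᵐ[volume] f := by
  refine ⟨𝓕⁻ ((hfc.toSchwartzMap hf).toLp 2 : L2 d), ?_⟩
  rw [FourierTransform.fourier_fourierInv_eq]
  exact (hfc.toSchwartzMap hf).coeFn_toLp 2

/-- Nonempty open sets carry nonzero vectors with smooth compactly supported Fourier transform. -/
theorem exists_ne_zero_fourierInCcInfty {O : Set (Euc d)} (hO : IsOpen O) {ξ : Euc d}
    (hξ : ξ ∈ O) : ∃ ψ : L2 d, ψ ≠ 0 ∧ FourierInCcInfty O ψ := by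
  obtain ⟨b, hbO, hbc, hb, -, hb1⟩ := exists_contDiff_tsupport_subset (n := ⊤) (hO.mem_nhds hξ)
  have hfc : HasCompactSupport fun η => (b η : ℂ) := hbc.comp_left Complex.ofReal_zero
  have hf : ContDiff ℝ ∞ fun η => (b η : ℂ) := Complex.ofRealCLM.contDiff.comp hb
  have hfO : tsupport (fun η => (b η : ℂ)) ⊆ O :=
    (closure_mono (Function.support_comp_subset Complex.ofReal_zero b)).trans hbO
  obtain ⟨ψ, hψ⟩ := exists_fourier_ae_eq hf hfc
  refine ⟨ψ, fun h0 => ?_, _, hf, hfc, hfO, hψ⟩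
  have h1 : (𝓕 ψ : L2 d) = 0 := by
    rw [h0]; exact map_zero (Lp.fourierTransformₗᵢ (Euc d) ℂ)
  rw [h1] at hψ
  have h2 : (fun η => (b η : ℂ)) =ᵐ[volume] fun _ => 0 := hψ.symm.trans (Lp.coeFn_zero _ _ _)
  have h3 := congrFun ((hf.continuous.ae_eq_iff_eq volume continuous_const).1 h2) ξ
  simp [hb1] at h3

end Integrability

theorem theorem2p1 {d : ℕ} (H : Subgroup (GL (Fin d) ℝ))
    (hH : IsClosed (H : Set (GL (Fin d) ℝ)))
    (μH : Measure H) [μH.IsHaarMeasure]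
    (hirr : QuasiRegIrreducible H)
    (hsq : QuasiRegSquareIntegrable H μH)
    (v : AffGroup H → ℝ) (hv : IsWeight v)
    (w : H → ℝ) (hw : IsWeight w) (s : ℝ)
    (hvw : ∀ (x : Euc d) (h : H), v (AffGroup.mk x h) ≤ (1 + ‖x‖) ^ s * w h) :
    (∃! O : Set (Euc d), IsOpenDualOrbit H O) ∧
    QuasiRegIntegrable H μH v ∧
    ∀ O : Set (Euc d), IsOpenDualOrbit H O →
      ∀ ψ : L2 d, FourierInCcInfty O ψ → MemL1v μH v (wavelet ψ ψ) := by
  obtain ⟨ξ₁, hconull, E, hE, hE0, hEtop⟩ := exists_conull_dualOrbit hH μH hirr hsq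
  have hnull : volume (dualOrbit H ξ₁)ᶜ = 0 := hconull
  have hO₁ : IsOpen (dualOrbit H ξ₁) := by
    refine isOpen_dualOrbit_of_volume_ne_zero hH fun h0 => ?_
    have h1 : volume (Set.univ : Set (Euc d)) ≤ 0 := by
      rw [← Set.union_compl_self (dualOrbit H ξ₁)]
      exact (measure_union_le _ _).trans (by rw [h0, hnull, add_zero])
    exact isOpen_univ.measure_ne_zero volume Set.univ_nonempty (le_antisymm h1 zero_le)
  have huniq : ∀ O : Set (Euc d), IsOpenDualOrbit H O → O = dualOrbit H ξ₁ := by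
    rintro _ ⟨hO, ξ', rfl⟩
    -- A nonempty open set is not null, so every open orbit meets the conull one and equals it.
    have h1 : ¬ (dualOrbit H ξ' ⊆ (dualOrbit H ξ₁)ᶜ) := fun h =>
      hO.measure_ne_zero volume ⟨ξ', mem_dualOrbit_self ξ'⟩ (measure_mono_null h hnull)
    obtain ⟨η, hη', hη⟩ := Set.not_subset.1 h1
    rw [← dualOrbit_eq_of_mem hη', dualOrbit_eq_of_mem (not_not.1 hη)]
  have hint : ∀ ψ : L2 d, FourierInCcInfty (dualOrbit H ξ₁) ψ → MemL1v μH v (wavelet ψ ψ) :=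
    fun ψ hψ => memL1v_of_fourierInCcInfty hH μH hv hw hvw
      (fun K hK hKO => exists_isCompact_return hH μH hE hE0 hEtop hO₁ hK hKO) hψ
  refine ⟨⟨dualOrbit H ξ₁, ⟨hO₁, ξ₁, rfl⟩, huniq⟩, ?_, fun O hO ψ hψ => ?_⟩
  · obtain ⟨ψ, hψ0, hψ⟩ := exists_ne_zero_fourierInCcInfty hO₁ (mem_dualOrbit_self ξ₁)
    exact ⟨ψ, hψ0, hint ψ hψ⟩
  · rw [huniq O hO] at hψ
    exact hint ψ hψ
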